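/- Let $\Omega\subset\mathbb R^2$ be a bounded strictly convex domain with boundary $\Gamma$. Let $C^1_0(\overline\Omega)$ be the set of functions that are $C^1$ in $\Omega$, are continuous together with their first derivatives up to $\Gamma$, and vanish on $\Gamma$; they are extended by zero outside $\Omega$. For $x\in\overline\Omega$ and a unit vector $\theta\in\mathbf S^1$ let $\tau_\pm(x,\theta)=\max\{t\ge 0: x\pm t\theta\in\overline\Omega\}$, $\tau=\tau_++\tau_-$, and $x^\pm_\theta=x\pm\tau_\pm(x,\theta)\theta$. Fix a real valued attenuation $a\in C^1_0(\overline\Omega)$ and put $Da(x,\theta)=\int_0^{\tau(x,\theta)}a(x+t\theta)\,dt$. The attenuated X-ray transform of a function $f$ and the attenuated Doppler transform of a vector field $\mathbf F$ are $$X_af(x,\theta)=\int_{-\tau_-(x,\theta)}^{\tau_+(x,\theta)}f(x+t\theta)\,e^{-Da(x+t\theta,\theta)}\,dt,\qquad X_a\mathbf F(x,\theta)=\int_{-\tau_-(x,\theta)}^{\tau_+(x,\theta)}\theta\cdot\mathbf F(x+t\theta)\,e^{-Da(x+t\theta,\theta)}\,dt .$$ A function $g:\Gamma\times\mathbf S^1\to\mathbb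 R$ is called attenuated X-ray data of $f$ (respectively, attenuated Doppler data of $\mathbf F$) if $g(x^+_\theta,\theta)-e^{-Da(x^-_\theta,\theta)}g(x^-_\theta,\theta)$ equals $X_af(x,\theta)$ (respectively, $X_a\mathbf F(x,\theta)$) for all $(x,\theta)\in\overline\Omega\times\mathbf S^1$. Let $\mathbf F\in C^1_0(\overline\Omega;\mathbb R^2)$ be a real solenoidal vector field ($\operatorname{div}\mathbf F=0$ in $\Omega$) and let $f\in C^1_0(\overline\Omega)$ be a real valued function. Then the attenuated Doppler data of $\mathbf F$ cannot coincide with the attenuated X-ray data of $f$, for the same attenuation $a$, except in the trivial case of zero data. That is, if some $g$ is at the same time attenuated Doppler data of $\mathbf F$ and attenuated X-ray data of $f$, or if $X_a\mathbf F=X_af$ on $\Omega\times\mathbf S^1$, then $X_a\mathbf F=X_af=0$ on $\overline\Omega\times\mathbf S^1$, and moreover $\mathbf F=0$ and $f=0$. -/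

import Mathlib

noncomputable section

namespace RayData

/-- The Euclidean plane. -/
abbrev Plane := EuclideanSpace ℝ (Fin 2)

/-- A bounded strictly convex domain of the plane: bounded, open and convex, with no line segment
in its boundary (for an open set the last point is a condition on the closure). -/
structure IsStrictlyConvexDomain (Ω : Set Plane) : Prop where
  isOpen : IsOpen Ω
  nonempty : Ω.Nonempty
  isBounded : Bornology.IsBounded Ω
  convex : Convex ℝ Ω
  strictConvex_closure : StrictConvex ℝ (closure Ω)

/-- The class `C¹₀(closure Ω)`: functions that are continuously differentiable in `Ω`, with
derivative extending continuously to `closure Ω`, and that are continuous and vanish on the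
boundary. They are extended by zero to the plane, so that continuity on the plane contains
continuity on `closure Ω`. -/
structure IsC1Zero {V : Type*} [NormedAddCommGroup V] [NormedSpace ℝ V]
    (Ω : Set Plane) (f : Plane → V) : Prop where
  continuous : Continuous f
  eq_zero_of_notMem : ∀ x, x ∉ Ω → f x = 0
  exists_fderiv : ∃ f' : Plane → Plane →L[ℝ] V,
    ContinuousOn f' (closure Ω) ∧ ∀ x ∈ Ω, HasFDerivAt f (f' x) x

/-- The divergence `∂₁ F₁ + ∂₂ F₂`. -/
def divergence (F : Plane → Plane) (x : Plane) : ℝ :=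
  ∑ i : Fin 2, fderiv ℝ F x (EuclideanSpace.single i 1) i

/-- `F` is solenoidal (divergence free) in `Ω`. -/
def IsSolenoidal (Ω : Set Plane) (F : Plane → Plane) : Prop :=
  ∀ x ∈ Ω, divergence F x = 0

/-- `τ₊(x, θ)`: the distance from `x ∈ closure Ω` in the direction `θ` to the end of the chord. -/
def tauPlus (Ω : Set Plane) (x θ : Plane) : ℝ :=
  sSup {t : ℝ | 0 ≤ t ∧ x + t • θ ∈ closure Ω}

/-- `τ₋(x, θ)`: the distance from `x ∈ closure Ω` in the direction `-θ` to the end of the chord. -/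
def tauMinus (Ω : Set Plane) (x θ : Plane) : ℝ :=
  tauPlus Ω x (-θ)

/-- The length `τ = τ₊ + τ₋` of the chord through `x` in the direction `θ`. -/
def chordLength (Ω : Set Plane) (x θ : Plane) : ℝ :=
  tauPlus Ω x θ + tauMinus Ω x θ

/-- The endpoint `x⁺_θ = x + τ₊ θ` of the chord. -/
def exitPoint (Ω : Set Plane) (x θ : Plane) : Plane :=
  x + tauPlus Ω x θ • θ

/-- The endpoint `x⁻_θ = x - τ₋ θ` of the chord. -/
def entryPoint (Ω : Set Plane) (x θ : Plane) : Plane :=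
  x - tauMinus Ω x θ • θ

/-- The divergence beam transform `Da(x, θ) = ∫₀^τ a(x + tθ) dt`. (The function `a` is extended
by zero, so nothing is added beyond the exit point.) -/
def divBeam (Ω : Set Plane) (a : Plane → ℝ) (x θ : Plane) : ℝ :=
  ∫ t in (0 : ℝ)..chordLength Ω x θ, a (x + t • θ)

/-- The attenuated X-ray transform of `f` with attenuation `a`. -/
def attenuatedXray (Ω : Set Plane) (a f : Plane → ℝ) (x θ : Plane) : ℝ :=
  ∫ t in (-tauMinus Ω x θ)..tauPlus Ω x θ,
    f (x + t • θ) * Real.exp (-divBeam Ω a (x + t • θ) θ)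

/-- The attenuated Doppler transform of the vector field `F` with attenuation `a`. -/
def attenuatedDoppler (Ω : Set Plane) (a : Plane → ℝ) (F : Plane → Plane) (x θ : Plane) : ℝ :=
  ∫ t in (-tauMinus Ω x θ)..tauPlus Ω x θ,
    inner ℝ θ (F (x + t • θ)) * Real.exp (-divBeam Ω a (x + t • θ) θ)

/-- `g` is attenuated X-ray data of `f`. Only the values of `g` at boundary points and unit
vectors are used. -/
def IsXrayData (Ω : Set Plane) (a f : Plane → ℝ) (g : Plane → Plane → ℝ) : Prop :=
  ∀ x ∈ closure Ω, ∀ θ : Plane, ‖θ‖ = 1 →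
    g (exitPoint Ω x θ) θ
        - Real.exp (-divBeam Ω a (entryPoint Ω x θ) θ) * g (entryPoint Ω x θ) θ
      = attenuatedXray Ω a f x θ

/-- `g` is attenuated Doppler data of `F`. Only the values of `g` at boundary points and unit
vectors are used. -/
def IsDopplerData (Ω : Set Plane) (a : Plane → ℝ) (F : Plane → Plane)
    (g : Plane → Plane → ℝ) : Prop :=
  ∀ x ∈ closure Ω, ∀ θ : Plane, ‖θ‖ = 1 →
    g (exitPoint Ω x θ) θ
        - Real.exp (-divBeam Ω a (entryPoint Ω x θ) θ) * g (entryPoint Ω x θ) θ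
      = attenuatedDoppler Ω a F x θ

end RayData

end

/-!
The data hypothesis says that the attenuated transform of `f - θ · F` vanishes on every chord. The
proof determines the kernel of this transform on pairs `(f, F)`: it consists of the pairs
`F = ∇P`, `f = -a P` with `P` vanishing far away (`exists_potential`). If `F = ∇P` is moreover
divergence free in `Ω`, its complex conjugate is holomorphic there, continuous and zero on the
boundary, so the maximum modulus principle gives `F = 0`
(`eq_zero_of_gradient_of_divergence`); then `P` is constant, hence zero, and `f = -a P = 0`.

For the kernel, the plane is identified with `ℂ` and the directions with `θ = e^{iφ}`. Let
`u(x, φ)` be the solution of `θ · ∇u + a u = -(f - θ · F)` that vanishes beyond the support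
(`transportSol`); as the data vanish, it vanishes before the support as well. The key point is that
`u` does not depend on `φ` (`transportSol_eq_of_data`), which rests on two facts.

* There is a holomorphic integrating factor: a solution `w` of `θ · ∇w = a` that has no negative
  Fourier modes in `φ` (`holExponent`, `isHardy_holExponent`). It is the odd part of the beam
  transform of `a`, corrected by the Hilbert transform of the Radon transform of `a`, which is
  constant along lines.
* The function `v = e^w u` solves `θ · ∇v = -e^w (f - θ · F)`, where the right side has no modes
  below `-1`. A Fourier transform in `x` shows that the negative modes of `v(x, ·)` of equal parity
  have transforms of equal modulus; as the modes tend to zero, they all vanish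
  (`angMode_eq_zero_of_lineDeriv`).

So `u = e^{-w} v` has no negative modes, and, being real, no positive ones either. With
`u(x, φ) = P(x)`, the transport equation reads `θ · ∇P = -a P - f + θ · F`, and its even and odd
parts in `θ` give `f = -a P` and `∇P = F`.
-/

namespace RayData

open MeasureTheory Complex Set Filter Topology
open scoped Real ComplexConjugate NNReal FourierTransform

/-! ### Angular Fourier modes and the Hardy class of the circle -/

/-- The `m`-th angular mode `∫₀^{2π} e^{-imφ} f(φ) dφ` of a function of the angle. -/
noncomputable def angMode (m : ℤ) (f : ℝ → ℂ) : ℂ :=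
  ∫ φ in (0 : ℝ)..2 * π, cexp (-(m * φ * I)) * f φ

/-- Boundary values of the functions that are continuous on the closed unit disc and holomorphic
inside: the continuous periodic functions whose negative angular modes vanish. -/
structure IsHardy (f : ℝ → ℂ) : Prop where
  continuous : Continuous f
  periodic : Function.Periodic f (2 * π)
  angMode_eq_zero : ∀ m : ℤ, m < 0 → angMode m f = 0

local instance factTwoPiPos : Fact (0 < 2 * π) := ⟨Real.two_pi_pos⟩

lemma exists_lift {f : ℝ → ℂ} (hc : Continuous f) (hp : Function.Periodic f (2 * π)) :
    ∃ g : C(AddCircle (2 * π), ℂ), ∀ φ : ℝ, g (φ : AddCircle (2 * π)) = f φ :=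
  ⟨⟨hp.lift, continuous_coinduced_dom.mpr hc⟩, fun φ => hp.lift_coe φ⟩

lemma angMode_eq_fourierCoeff (g : AddCircle (2 * π) → ℂ) (m : ℤ) :
    angMode m (fun φ => g φ) = 2 * π * fourierCoeff g m := by
  rw [fourierCoeff_eq_intervalIntegral g m 0]
  have hpi : (2 * (π : ℂ)) ≠ 0 := by
    simp [Real.pi_ne_zero]
  rw [zero_add, angMode, Complex.real_smul]
  push_cast
  rw [← mul_assoc, mul_one_div_cancel hpi, one_mul]
  refine intervalIntegral.integral_congr fun φ _ => ?_
  simp only [fourier_coe_apply, smul_eq_mul]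
  congr 2
  push_cast
  field_simp

lemma fourierCoeff_mul_eq_zero {p q : C(AddCircle (2 * π), ℂ)}
    (hp : ∀ n : ℤ, n < 0 → fourierCoeff p n = 0) (hq : ∀ n : ℤ, n < 0 → fourierCoeff q n = 0)
    {m : ℤ} (hm : m < 0) : fourierCoeff (fun x => p x * q x) m = 0 := by
  set P : Lp ℂ 2 (@AddCircle.haarAddCircle (2 * π) _) :=
    ContinuousMap.toLp 2 AddCircle.haarAddCircle ℂ (star (fourier (-m) * p)) with hP
  set Q : Lp ℂ 2 (@AddCircle.haarAddCircle (2 * π) _) :=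
    ContinuousMap.toLp 2 AddCircle.haarAddCircle ℂ q with hQ
  have key := (fourierBasis (T := 2 * π)).tsum_inner_mul_inner P Q
  have hz : ∀ n : ℤ, inner ℂ P (fourierBasis (T := 2 * π) n)
      * inner ℂ (fourierBasis (T := 2 * π) n) Q = 0 := by
    intro n
    rcases lt_or_ge n 0 with hn | hn
    · rw [← HilbertBasis.repr_apply_apply, fourierBasis_repr, hQ, fourierCoeff_toLp, hq n hn,
        mul_zero]
    · have : inner ℂ P (fourierBasis (T := 2 * π) n) = fourierCoeff p (m - n) := by
        rw [coe_fourierBasis, fourierLp, hP, ContinuousMap.inner_toLp]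
        refine integral_congr_ae (Eventually.of_forall fun x => ?_)
        simp only [ContinuousMap.star_apply, ContinuousMap.mul_apply, RCLike.star_def,
          Complex.conj_conj, smul_eq_mul]
        rw [show -(m - n) = n + -m by ring, fourier_add]
        ring
      rw [this, hp _ (by omega), zero_mul]
  simp only [hz, tsum_zero] at key
  rw [hP, hQ, ContinuousMap.inner_toLp] at key
  rw [fourierCoeff, key]
  refine integral_congr_ae (Eventually.of_forall fun x => ?_)
  simp only [ContinuousMap.star_apply, ContinuousMap.mul_apply, RCLike.star_def,
    Complex.conj_conj, smul_eq_mul]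
  ring

lemma IsHardy.mul {f g : ℝ → ℂ} (hf : IsHardy f) (hg : IsHardy g) :
    IsHardy (fun φ => f φ * g φ) := by
  refine ⟨hf.continuous.mul hg.continuous, fun φ => by
    simp only [hf.periodic φ, hg.periodic φ], fun m hm => ?_⟩
  obtain ⟨p, hp⟩ := exists_lift hf.continuous hf.periodic
  obtain ⟨q, hq⟩ := exists_lift hg.continuous hg.periodic
  have h2 : (2 * (π : ℂ)) ≠ 0 := by simp [Real.pi_ne_zero]
  have hp' : ∀ n : ℤ, n < 0 → fourierCoeff p n = 0 := fun n hn => by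
    have := hf.angMode_eq_zero n hn
    rw [← funext hp, angMode_eq_fourierCoeff] at this
    exact (mul_eq_zero.mp this).resolve_left h2
  have hq' : ∀ n : ℤ, n < 0 → fourierCoeff q n = 0 := fun n hn => by
    have := hg.angMode_eq_zero n hn
    rw [← funext hq, angMode_eq_fourierCoeff] at this
    exact (mul_eq_zero.mp this).resolve_left h2
  simp only [← hp, ← hq]
  rw [angMode_eq_fourierCoeff (fun x => p x * q x), fourierCoeff_mul_eq_zero hp' hq' hm, mul_zero]

lemma angMode_const {m : ℤ} (hm : m ≠ 0) (c : ℂ) : angMode m (fun _ => c) = 0 := by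
  have h := fourierCoeff_fourier (T := 2 * π) 0
  have h1 : angMode m (fun _ => 1) = 0 := by
    have := angMode_eq_fourierCoeff (fourier (T := 2 * π) 0) m
    rw [h, Pi.single_eq_of_ne hm, mul_zero] at this
    simpa only [fourier_zero] using this
  have : angMode m (fun _ => c) = angMode m (fun _ => 1) * c := by
    rw [angMode, angMode, ← intervalIntegral.integral_mul_const]
    simp
  rw [this, h1, zero_mul]

lemma IsHardy.const (c : ℂ) : IsHardy (fun _ => c) :=
  ⟨continuous_const, fun _ => rfl, fun _ hm => angMode_const hm.ne c⟩

lemma IsHardy.pow {f : ℝ → ℂ} (hf : IsHardy f) (n : ℕ) : IsHardy (fun φ => f φ ^ n) := by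
  induction n with
  | zero => simpa using IsHardy.const 1
  | succ n ih => simpa only [pow_succ] using ih.mul hf

lemma IsHardy.neg {f : ℝ → ℂ} (hf : IsHardy f) : IsHardy (fun φ => -f φ) := by
  simpa using (IsHardy.const (-1)).mul hf

/-- The exponential series converges uniformly, so it may be integrated term by term. -/
lemma IsHardy.cexp {f : ℝ → ℂ} (hf : IsHardy f) : IsHardy (fun φ => cexp (f φ)) := by
  refine ⟨Complex.continuous_exp.comp hf.continuous, fun φ => by
    simp only [hf.periodic φ], fun m hm => ?_⟩
  obtain ⟨C, hC⟩ := (isCompact_Icc (a := (0 : ℝ)) (b := 2 * π)).exists_bound_of_continuousOn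
    hf.continuous.continuousOn
  have hs := intervalIntegral.hasSum_integral_of_dominated_convergence (μ := volume)
    (a := 0) (b := 2 * π)
    (F := fun (n : ℕ) φ => Complex.exp (-(m * φ * I)) * ((n.factorial : ℂ)⁻¹ * f φ ^ n))
    (f := fun φ => Complex.exp (-(m * φ * I)) * Complex.exp (f φ))
    (fun n _ => (n.factorial : ℝ)⁻¹ * C ^ n)
    (fun n => by
      have := hf.continuous
      exact Continuous.aestronglyMeasurable (by fun_prop))
    (fun n => Eventually.of_forall fun φ hφ => by
      rw [uIoc_of_le Real.two_pi_pos.le] at hφ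
      rw [norm_mul, norm_mul, show -(m * φ * I) = ((-(m * φ) : ℝ) : ℂ) * I by push_cast; ring,
        Complex.norm_exp_ofReal_mul_I, one_mul, norm_pow, norm_inv]
      simp only [RCLike.norm_natCast]
      gcongr
      exact hC φ ⟨hφ.1.le, hφ.2⟩)
    (Eventually.of_forall fun φ _ => by
      simpa [div_eq_inv_mul] using Real.summable_pow_div_factorial C)
    (by simp)
    (Eventually.of_forall fun φ _ => by
      have := NormedSpace.expSeries_div_hasSum_exp (f φ)
      rw [← Complex.exp_eq_exp_ℂ] at this
      simpa [div_eq_inv_mul] using this.mul_left (Complex.exp (-(m * φ * I))))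
  have h0 : ∀ n : ℕ, ∫ φ in (0 : ℝ)..2 * π,
      Complex.exp (-(m * φ * I)) * ((n.factorial : ℂ)⁻¹ * f φ ^ n) = 0 := fun n =>
    ((IsHardy.const (n.factorial : ℂ)⁻¹).mul (hf.pow n)).angMode_eq_zero m hm
  simp only [h0] at hs
  exact hs.unique hasSum_zero

lemma tendsto_angMode_atBot {f : ℝ → ℂ} (hc : Continuous f)
    (hp : Function.Periodic f (2 * π)) : Tendsto (fun m => angMode m f) atBot (𝓝 0) := by
  obtain ⟨g, hg⟩ := exists_lift hc hp
  have hs := (hasSum_sq_fourierCoeff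
    (ContinuousMap.toLp 2 (@AddCircle.haarAddCircle (2 * π) _) ℂ g)).summable
  simp only [fourierCoeff_toLp] at hs
  have h0 := hs.tendsto_cofinite_zero
  rw [Int.cofinite_eq, tendsto_sup] at h0
  have h1 : Tendsto (fun m => ‖fourierCoeff g m‖) atBot (𝓝 0) := by
    simpa [Function.comp_def] using (Real.continuous_sqrt.tendsto 0).comp h0.1
  have h2 := (tendsto_zero_iff_norm_tendsto_zero.mpr h1).const_mul (2 * (π : ℂ))
  rw [mul_zero] at h2
  refine h2.congr fun m => ?_
  rw [← angMode_eq_fourierCoeff, funext hg]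

lemma eq_const_of_angMode_eq_zero {f : ℝ → ℂ} (hc : Continuous f)
    (hp : Function.Periodic f (2 * π)) (h0 : ∀ m : ℤ, m ≠ 0 → angMode m f = 0) (φ ψ : ℝ) :
    f φ = f ψ := by
  obtain ⟨g, hg⟩ := exists_lift hc hp
  have h2 : (2 * (π : ℂ)) ≠ 0 := by simp [Real.pi_ne_zero]
  have hg0 : ∀ n : ℤ, n ≠ 0 → fourierCoeff g n = 0 := fun n hn => by
    have := h0 n hn
    rw [← funext hg, angMode_eq_fourierCoeff] at this
    exact (mul_eq_zero.mp this).resolve_left h2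
  have hs : Summable (fourierCoeff g) :=
    summable_of_ne_finset_zero (s := {0}) fun n hn => hg0 n (by simpa using hn)
  have key : ∀ x, g x = fourierCoeff g 0 := fun x => by
    have := has_pointwise_sum_fourier_series_of_summable hs x
    have h' := hasSum_single (f := fun i => fourierCoeff g i • fourier i x) 0
      (fun n hn => by simp [hg0 n hn])
    simpa using this.unique h'
  rw [← hg, ← hg, key, key]

lemma angMode_conj (m : ℤ) (f : ℝ → ℂ) :
    angMode m (fun φ => conj (f φ)) = conj (angMode (-m) f) := by
  rw [angMode, angMode, intervalIntegral.intervalIntegral_eq_integral_uIoc,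
    intervalIntegral.intervalIntegral_eq_integral_uIoc, if_pos Real.two_pi_pos.le, one_smul,
    one_smul, ← integral_conj]
  refine integral_congr_ae (Eventually.of_forall fun φ => ?_)
  simp only [map_mul, ← Complex.exp_conj, map_neg, conj_I, conj_ofReal, Int.cast_neg, map_intCast]
  congr 2
  ring

/-- For real functions the positive modes are conjugate to the negative ones. -/
lemma IsHardy.eq_of_real {f : ℝ → ℝ} (hf : IsHardy (fun φ => (f φ : ℂ))) (φ ψ : ℝ) :
    f φ = f ψ := by
  have := eq_const_of_angMode_eq_zero hf.continuous hf.periodic (fun m hm => by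
    rcases lt_or_gt_of_ne hm with h | h
    · exact hf.angMode_eq_zero m h
    · have := angMode_conj m (fun φ => (f φ : ℂ))
      simp only [conj_ofReal] at this
      rw [this, hf.angMode_eq_zero (-m) (by omega), map_zero]) φ ψ
  exact_mod_cast this

/-! ### Line integrals and the holomorphic integrating factor -/

/-- The unit vector `e^{iφ}`. -/
noncomputable def dir (φ : ℝ) : ℂ := cexp (φ * I)

/-- The point with coordinates `p` along `e^{iφ}` and `s` along `i e^{iφ}`. -/
noncomputable def linePt (φ p s : ℝ) : ℂ := (p + s * I) * dir φ

/-- The coordinate of `x` along `e^{iφ}`. -/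
noncomputable def coordPar (φ : ℝ) (x : ℂ) : ℝ := (x * conj (dir φ)).re

/-- The coordinate of `x` along `i e^{iφ}`. -/
noncomputable def coordPerp (φ : ℝ) (x : ℂ) : ℝ := (x * conj (dir φ)).im

@[fun_prop]
lemma continuous_dir : Continuous dir := by unfold dir; fun_prop

@[simp]
lemma norm_dir (φ : ℝ) : ‖dir φ‖ = 1 := Complex.norm_exp_ofReal_mul_I φ

lemma dir_add (φ ψ : ℝ) : dir (φ + ψ) = dir φ * dir ψ := by
  simp only [dir, ← Complex.exp_add]; push_cast; ring_nf

lemma dir_add_two_pi (φ : ℝ) : dir (φ + 2 * π) = dir φ := by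
  rw [dir_add]; simp [dir]

lemma dir_add_pi (φ : ℝ) : dir (φ + π) = -dir φ := by
  rw [dir_add]; simp [dir]

@[simp]
lemma dir_mul_conj (φ : ℝ) : dir φ * conj (dir φ) = 1 := by
  rw [Complex.mul_conj, Complex.normSq_eq_norm_sq, norm_dir]; simp

lemma dir_eq (φ : ℝ) : dir φ = Real.cos φ + Real.sin φ * I := by
  rw [dir, Complex.exp_mul_I, Complex.ofReal_cos, Complex.ofReal_sin]

lemma linePt_coord (φ : ℝ) (x : ℂ) : linePt φ (coordPar φ x) (coordPerp φ x) = x := by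
  rw [linePt, coordPar, coordPerp, Complex.re_add_im, mul_assoc, mul_comm (conj _), dir_mul_conj,
    mul_one]

lemma coordPar_add (φ : ℝ) (x : ℂ) (t : ℝ) :
    coordPar φ (x + t * dir φ) = coordPar φ x + t := by
  simp [coordPar, add_mul, mul_assoc, -mul_re]

lemma coordPerp_add (φ : ℝ) (x : ℂ) (t : ℝ) :
    coordPerp φ (x + t * dir φ) = coordPerp φ x := by
  simp [coordPerp, add_mul, mul_assoc, -mul_im]

lemma norm_linePt_sq (φ p s : ℝ) : ‖linePt φ p s‖ ^ 2 = p ^ 2 + s ^ 2 := by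
  rw [linePt, norm_mul, norm_dir, mul_one, Complex.sq_norm, Complex.normSq_add_mul_I]

lemma abs_coordPar_le (φ : ℝ) (x : ℂ) : |coordPar φ x| ≤ ‖x‖ := by
  refine (Complex.abs_re_le_norm _).trans ?_
  simp

lemma le_norm_linePt (φ p s : ℝ) : |p| ≤ ‖linePt φ p s‖ := by
  refine abs_le_of_sq_le_sq ?_ (norm_nonneg _)
  rw [norm_linePt_sq]; nlinarith [sq_nonneg s]

lemma linePt_sub (φ p s p' s' : ℝ) :
    linePt φ (p - p') (s - s') = linePt φ p s - linePt φ p' s' := by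
  simp only [linePt]; push_cast; ring

@[fun_prop]
lemma continuous_linePt : Continuous fun z : ℝ × ℝ × ℝ => linePt z.1 z.2.1 z.2.2 := by
  unfold linePt; fun_prop

@[fun_prop]
lemma continuous_coordPar : Continuous fun z : ℝ × ℂ => coordPar z.1 z.2 := by
  unfold coordPar; fun_prop

@[fun_prop]
lemma continuous_coordPerp : Continuous fun z : ℝ × ℂ => coordPerp z.1 z.2 := by
  unfold coordPerp; fun_prop

/-- The part after `p` of the integral of `q` over the line at distance `s` in the direction
`e^{iφ}`, for a function `q` that vanishes off the disc of radius `ρ`. -/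
noncomputable def lineFwd (ρ : ℝ) (q : ℂ → ℝ) (φ p s : ℝ) : ℝ :=
  ∫ σ in p..ρ, q (linePt φ σ s)

/-- The part before `p` of the integral of `q` over a line. -/
noncomputable def lineBwd (ρ : ℝ) (q : ℂ → ℝ) (φ p s : ℝ) : ℝ :=
  ∫ σ in (-ρ)..p, q (linePt φ σ s)

/-- The Radon transform, for functions that vanish off the disc of radius `ρ`. -/
noncomputable def radon (ρ : ℝ) (q : ℂ → ℝ) (φ s : ℝ) : ℝ :=
  ∫ σ in (-ρ)..ρ, q (linePt φ σ s)

/-- The Hilbert transform, in the affine variable, of the Radon transform: twice the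
principal value of `∫ R(s - t) / t dt`, symmetrized so that the integral converges absolutely for
Lipschitz functions (the junk value at `t = 0` is on a null set). The truncation at `2ρ` does not matter for the lines that meet the disc of radius `ρ`. -/
noncomputable def hilbertRadon (ρ : ℝ) (q : ℂ → ℝ) (φ s : ℝ) : ℝ :=
  ∫ t in (-(2 * ρ))..(2 * ρ), (radon ρ q φ (s - t) - radon ρ q φ (s + t)) / t

/-- The exponent of the holomorphic integrating factor: a solution `w` of `θ · ∇w = a` whose
negative angular modes vanish in the disc of radius `ρ`. The coefficient of the Hilbert transform is
the one for which its negative modes cancel those of the first term. -/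
noncomputable def holExponent (ρ : ℝ) (a : ℂ → ℝ) (φ : ℝ) (x : ℂ) : ℂ :=
  ((lineBwd ρ a φ (coordPar φ x) (coordPerp φ x)
    - lineFwd ρ a φ (coordPar φ x) (coordPerp φ x) : ℝ) : ℂ) / 2
    - I / (4 * π) * (hilbertRadon ρ a φ (coordPerp φ x) : ℝ)

section Regularity

variable {ρ : ℝ} {a : ℂ → ℝ}

lemma continuous_lineFwd (ha : Continuous a) :
    Continuous fun z : ℝ × ℝ × ℝ => lineFwd ρ a z.1 z.2.1 z.2.2 := by
  have : ∀ z : ℝ × ℝ × ℝ, lineFwd ρ a z.1 z.2.1 z.2.2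
      = -∫ σ in ρ..z.2.1, a (linePt z.1 σ z.2.2) := fun z =>
    intervalIntegral.integral_symm _ _
  simp only [this]
  refine (intervalIntegral.continuous_parametric_intervalIntegral_of_continuous
    (f := fun (z : ℝ × ℝ × ℝ) σ => a (linePt z.1 σ z.2.2)) ?_ (by fun_prop)).neg
  exact ha.comp (continuous_linePt.comp
    (f := fun z : (ℝ × ℝ × ℝ) × ℝ => (z.1.1, z.2, z.1.2.2)) (by fun_prop))

lemma continuous_lineBwd (ha : Continuous a) :
    Continuous fun z : ℝ × ℝ × ℝ => lineBwd ρ a z.1 z.2.1 z.2.2 := by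
  refine (intervalIntegral.continuous_parametric_intervalIntegral_of_continuous
    (f := fun (z : ℝ × ℝ × ℝ) σ => a (linePt z.1 σ z.2.2)) ?_ (by fun_prop))
  exact ha.comp (continuous_linePt.comp
    (f := fun z : (ℝ × ℝ × ℝ) × ℝ => (z.1.1, z.2, z.1.2.2)) (by fun_prop))

lemma continuous_radon (ha : Continuous a) :
    Continuous fun z : ℝ × ℝ => radon ρ a z.1 z.2 :=
  (continuous_lineBwd ha).comp (f := fun z : ℝ × ℝ => (z.1, ρ, z.2)) (by fun_prop)

lemma hasDerivAt_lineFwd (ha : Continuous a) (φ p s : ℝ) :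
    HasDerivAt (fun p => lineFwd ρ a φ p s) (-a (linePt φ p s)) p := by
  have hc : Continuous fun σ => a (linePt φ σ s) := ha.comp
    (continuous_linePt.comp (f := fun σ : ℝ => (φ, σ, s)) (by fun_prop))
  exact intervalIntegral.integral_hasDerivAt_left (hc.intervalIntegrable _ _)
    (hc.stronglyMeasurableAtFilter _ _) hc.continuousAt

lemma hasDerivAt_lineBwd (ha : Continuous a) (φ p s : ℝ) :
    HasDerivAt (fun p => lineBwd ρ a φ p s) (a (linePt φ p s)) p := by
  have hc : Continuous fun σ => a (linePt φ σ s) := ha.comp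
    (continuous_linePt.comp (f := fun σ : ℝ => (φ, σ, s)) (by fun_prop))
  exact intervalIntegral.integral_hasDerivAt_right (hc.intervalIntegrable _ _)
    (hc.stronglyMeasurableAtFilter _ _) hc.continuousAt

lemma abs_radon_sub_le {K : ℝ≥0} (hρ : 0 ≤ ρ) (ha : LipschitzWith K a) (φ s s' : ℝ) :
    |radon ρ a φ s - radon ρ a φ s'| ≤ 2 * ρ * K * |s - s'| := by
  have hc : ∀ s, Continuous fun σ => a (linePt φ σ s) := fun s => ha.continuous.comp
    (continuous_linePt.comp (f := fun σ : ℝ => (φ, σ, s)) (by fun_prop))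
  rw [radon, radon, ← intervalIntegral.integral_sub ((hc _).intervalIntegrable _ _)
    ((hc _).intervalIntegrable _ _), ← Real.norm_eq_abs]
  refine (intervalIntegral.norm_integral_le_of_norm_le_const (C := K * |s - s'|) fun σ _ => ?_).trans
    (le_of_eq ?_)
  · refine (ha.dist_le_mul _ _).trans (le_of_eq ?_)
    rw [dist_eq_norm, ← linePt_sub, sub_self]
    simp only [linePt, ofReal_zero, zero_add, norm_mul, norm_I, mul_one, norm_dir,
      Complex.norm_real, Real.norm_eq_abs]
  · rw [show ρ - -ρ = 2 * ρ by ring, abs_of_nonneg (show 0 ≤ 2 * ρ by positivity)]; ring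

lemma continuous_hilbertRadon {K : ℝ≥0} (hρ : 0 ≤ ρ) (ha : LipschitzWith K a) :
    Continuous fun z : ℝ × ℝ => hilbertRadon ρ a z.1 z.2 := by
  have hR := continuous_radon (ρ := ρ) ha.continuous
  refine intervalIntegral.continuous_of_dominated_interval (bound := fun _ => 2 * ρ * K * 2)
    (fun z => ?_) (fun z => Eventually.of_forall fun t _ => ?_) (by simp)
    (Eventually.of_forall fun t _ => ?_)
  · refine (Measurable.div ?_ measurable_id).aestronglyMeasurable
    exact ((hR.comp (f := fun t : ℝ => (z.1, z.2 - t)) (by fun_prop)).sub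
      (hR.comp (f := fun t : ℝ => (z.1, z.2 + t)) (by fun_prop))).measurable
  · rw [Real.norm_eq_abs, abs_div]
    refine div_le_of_le_mul₀ (abs_nonneg _) (by positivity) ?_
    refine (abs_radon_sub_le hρ ha _ _ _).trans (le_of_eq ?_)
    rw [show z.2 - t - (z.2 + t) = -(2 * t) by ring, abs_neg, abs_mul, abs_two]; ring
  · exact ((hR.comp (f := fun z : ℝ × ℝ => (z.1, z.2 - t)) (by fun_prop)).sub
      (hR.comp (f := fun z : ℝ × ℝ => (z.1, z.2 + t)) (by fun_prop))).div_const _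

lemma continuous_holExponent {K : ℝ≥0} (hρ : 0 ≤ ρ) (ha : LipschitzWith K a) :
    Continuous fun z : ℝ × ℂ => holExponent ρ a z.1 z.2 := by
  unfold holExponent
  have h1 := (continuous_lineBwd (ρ := ρ) ha.continuous).comp
    (f := fun z : ℝ × ℂ => (z.1, coordPar z.1 z.2, coordPerp z.1 z.2)) (by fun_prop)
  have h2 := (continuous_lineFwd (ρ := ρ) ha.continuous).comp
    (f := fun z : ℝ × ℂ => (z.1, coordPar z.1 z.2, coordPerp z.1 z.2)) (by fun_prop)
  have h3 := (continuous_hilbertRadon hρ ha).comp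
    (f := fun z : ℝ × ℂ => (z.1, coordPerp z.1 z.2)) (by fun_prop)
  simp only [Function.comp_def] at h1 h2 h3
  fun_prop

lemma linePt_add_two_pi (φ p s : ℝ) : linePt (φ + 2 * π) p s = linePt φ p s := by
  simp only [linePt, dir_add_two_pi]

lemma holExponent_periodic (x : ℂ) : Function.Periodic (fun φ => holExponent ρ a φ x) (2 * π) := by
  intro φ
  simp only [holExponent, coordPar, coordPerp, dir_add_two_pi, lineBwd, lineFwd, hilbertRadon,
    radon, linePt_add_two_pi]

/-- `θ · ∇w = a`; the Hilbert transform of the Radon transform is constant along lines. -/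
lemma hasDerivAt_holExponent (ha : Continuous a) (φ : ℝ) (x : ℂ) :
    HasDerivAt (fun t : ℝ => holExponent ρ a φ (x + t * dir φ)) (a x : ℂ) 0 := by
  simp only [holExponent, coordPar_add, coordPerp_add]
  have h1 := (hasDerivAt_lineBwd (ρ := ρ) ha φ (coordPar φ x + 0) (coordPerp φ x)).comp_const_add
    (coordPar φ x) 0
  have h2 := (hasDerivAt_lineFwd (ρ := ρ) ha φ (coordPar φ x + 0) (coordPerp φ x)).comp_const_add
    (coordPar φ x) 0
  have h := (((h1.sub h2).ofReal_comp).div_const 2).sub_const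
    (I / (4 * π) * (hilbertRadon ρ a φ (coordPerp φ x) : ℝ))
  refine h.congr_deriv ?_
  rw [add_zero, linePt_coord]
  push_cast
  ring

end Regularity

lemma angMode_shift {f : ℝ → ℂ} (hp : Function.Periodic f (2 * π)) (m : ℤ) (β : ℝ) :
    angMode m (fun φ => f (φ + β)) = cexp (m * β * I) * angMode m f := by
  have h1 : angMode m (fun φ => f (φ + β)) = cexp (m * β * I) *
      ∫ φ in (0 : ℝ)..2 * π, cexp (-(m * (φ + β : ℝ) * I)) * f (φ + β) := by
    rw [angMode, ← intervalIntegral.integral_const_mul]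
    refine intervalIntegral.integral_congr fun φ _ => ?_
    simp only [← mul_assoc, ← Complex.exp_add]
    congr 2
    push_cast
    ring
  rw [h1, intervalIntegral.integral_comp_add_right
    (f := fun φ : ℝ => cexp (-(m * φ * I)) * f φ)]
  have hper : Function.Periodic (fun φ : ℝ => cexp (-(m * φ * I)) * f φ) (2 * π) := by
    intro φ
    simp only [hp φ]
    congr 1
    rw [show -((m : ℂ) * ((φ + 2 * π : ℝ) : ℂ) * I) = -(m * φ * I) + (-m : ℤ) * (2 * π * I) by
      push_cast; ring, Complex.exp_periodic.int_mul]
  rw [zero_add, add_comm (2 * π) β, hper.intervalIntegral_add_eq β 0, zero_add, angMode]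

/-! ### Angular modes of the integrating factor -/

/-- For real `β` with `sin β ≠ 0` the quotient is a trigonometric polynomial, whose frequencies
have the parity of `k - 1`. -/
lemma integral_cexp_sub_div_sin (k : ℕ) :
    ∫ β in Ioo (-π) π, (cexp (-(k * β * I)) - cexp (k * β * I)) / Real.sin β
      = -(2 * π * I) * (1 - (-1) ^ k) := by
  have hne : ∀ᵐ β ∂(volume.restrict (Ioo (-π) π)), Real.sin β ≠ 0 := by
    have h0 : ∀ᵐ β : ℝ ∂(volume.restrict (Ioo (-π) π)), β ≠ 0 :=
      ae_restrict_of_ae (Measure.ae_ne volume 0)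
    filter_upwards [h0, ae_restrict_mem measurableSet_Ioo] with β hβ hβ' hs
    rw [Real.sin_eq_zero_iff_of_lt_of_lt hβ'.1 hβ'.2] at hs
    exact hβ hs
  have hsum : ∀ β : ℝ, Real.sin β ≠ 0 →
      (cexp (-(k * β * I)) - cexp (k * β * I)) / Real.sin β
        = ∑ j ∈ Finset.range k, (-(2 * I)) * cexp (((2 * j + 1 - k : ℤ) : ℂ) * I * β) := by
    intro β hβ
    have hg := geom_sum₂_mul (cexp (β * I)) (cexp (-(β * I))) k
    have h2 : cexp (β * I) - cexp (-(β * I)) = 2 * I * Real.sin β := by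
      rw [Complex.ofReal_sin, Complex.sin]
      ring_nf
      rw [I_sq]
      ring
    rw [h2] at hg
    rw [div_eq_iff (by exact_mod_cast hβ), Finset.sum_mul,
      show cexp (-(k * β * I)) - cexp (k * β * I)
        = -(cexp (β * I) ^ k - cexp (-(β * I)) ^ k) by
        rw [← Complex.exp_nat_mul, ← Complex.exp_nat_mul]; ring_nf,
      ← hg, Finset.sum_mul, ← Finset.sum_neg_distrib]
    refine Finset.sum_congr rfl fun j hj => ?_
    have hjk : j + 1 ≤ k := Finset.mem_range.mp hj
    rw [← Complex.exp_nat_mul, ← Complex.exp_nat_mul, ← Complex.exp_add]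
    have : ((k - 1 - j : ℕ) : ℂ) = k - 1 - j := by
      rw [Nat.sub_sub, Nat.cast_sub (by omega)]; push_cast; ring
    rw [this]
    push_cast
    ring_nf
  have hint : ∀ n : ℤ, ∫ β in Ioo (-π) π, cexp ((n : ℂ) * I * (β : ℂ))
      = if n = 0 then 2 * (π : ℂ) else 0 := by
    intro n
    rw [← integral_Ioc_eq_integral_Ioo,
      ← intervalIntegral.integral_of_le (by linarith [Real.pi_pos])]
    split_ifs with hn
    · simp [hn]; ring
    · rw [integral_exp_mul_complex (by simpa using hn)]
      rw [show (n : ℂ) * I * (π : ℝ) = (n : ℂ) * I * ((-π : ℝ) : ℂ) + n * (2 * π * I) by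
        push_cast; ring, Complex.exp_periodic.int_mul, sub_self, zero_div]
  rw [integral_congr_ae (hne.mono fun β hβ => hsum β hβ), integral_finsetSum]
  · simp only [integral_const_mul, hint]
    rcases Nat.even_or_odd' k with ⟨l, rfl | rfl⟩
    · rw [Finset.sum_eq_zero fun j _ => by rw [if_neg (by push_cast; omega), mul_zero]]
      simp
    · rw [Finset.sum_eq_single_of_mem l (Finset.mem_range.mpr (by omega))
        (fun j _ hj => by rw [if_neg (by push_cast; omega), mul_zero]),
        if_pos (by push_cast; ring)]
      rw [pow_succ, pow_mul]
      norm_num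
      ring
  · intro j _
    refine Continuous.integrableOn_Icc (a := -π) (b := π) ?_ |>.mono_set Ioo_subset_Icc_self
    fun_prop

section Modes

variable {ρ : ℝ} {a : ℂ → ℝ}

lemma integral_eq_intervalIntegral_of_eq_zero {E : Type*} [NormedAddCommGroup E]
    [NormedSpace ℝ E] {f : ℝ → E} {α β : ℝ} (h : α ≤ β) (hf : ∀ t, t ∉ Icc α β → f t = 0) :
    ∫ t, f t = ∫ t in α..β, f t := by
  rw [intervalIntegral.integral_of_le h, ← integral_Icc_eq_integral_Ioc,
    setIntegral_eq_integral_of_forall_compl_eq_zero hf]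

lemma coord_sub_mul_dir (φ : ℝ) (x : ℂ) (p q : ℝ) :
    linePt φ (coordPar φ x - p) (coordPerp φ x - q) = x - (p + q * I) * dir φ := by
  rw [linePt_sub, linePt_coord, linePt]

lemma lineBwd_coord (ha : Continuous a) (ha0 : ∀ x, ρ ≤ ‖x‖ → a x = 0) (φ : ℝ) {x : ℂ}
    (hx : ‖x‖ ≤ ρ) :
    lineBwd ρ a φ (coordPar φ x) (coordPerp φ x) = ∫ r in (0 : ℝ)..2 * ρ, a (x - r * dir φ) := by
  have hp := abs_le.mp ((abs_coordPar_le φ x).trans hx)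
  have hc : Continuous fun σ => a (linePt φ σ (coordPerp φ x)) := ha.comp
    (continuous_linePt.comp (f := fun σ : ℝ => (φ, σ, coordPerp φ x)) (by fun_prop))
  have h1 : ∀ r : ℝ, a (x - r * dir φ) = a (linePt φ (coordPar φ x - r) (coordPerp φ x)) :=
    fun r => by
      have := coord_sub_mul_dir φ x r 0
      simp only [sub_zero, ofReal_zero, zero_mul, add_zero] at this
      rw [this]
  simp only [h1]
  rw [intervalIntegral.integral_comp_sub_left (fun σ => a (linePt φ σ (coordPerp φ x))), sub_zero,
    ← intervalIntegral.integral_add_adjacent_intervals (b := -ρ) (hc.intervalIntegrable _ _)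
      (hc.intervalIntegrable _ _), lineBwd]
  rw [intervalIntegral.integral_congr (b := -ρ) (g := fun _ => (0 : ℝ)),
    intervalIntegral.integral_zero, zero_add]
  intro σ hσ
  rw [uIcc_of_le (by linarith)] at hσ
  refine ha0 _ (le_trans ?_ (le_norm_linePt _ _ _))
  rw [abs_of_nonpos] <;> linarith [hσ.2, norm_nonneg x]

lemma lineFwd_coord (ha : Continuous a) (ha0 : ∀ x, ρ ≤ ‖x‖ → a x = 0) (φ : ℝ) {x : ℂ}
    (hx : ‖x‖ ≤ ρ) :
    lineFwd ρ a φ (coordPar φ x) (coordPerp φ x) = ∫ r in (0 : ℝ)..2 * ρ, a (x + r * dir φ) := by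
  have hp := abs_le.mp ((abs_coordPar_le φ x).trans hx)
  have hc : Continuous fun σ => a (linePt φ σ (coordPerp φ x)) := ha.comp
    (continuous_linePt.comp (f := fun σ : ℝ => (φ, σ, coordPerp φ x)) (by fun_prop))
  have h1 : ∀ r : ℝ, a (x + r * dir φ) = a (linePt φ (coordPar φ x + r) (coordPerp φ x)) :=
    fun r => by
      have := coord_sub_mul_dir φ x (-r) 0
      simp only [sub_zero, sub_neg_eq_add, ofReal_zero, ofReal_neg, zero_mul, add_zero,
        neg_mul] at this
      rw [this]
  simp only [h1]
  rw [intervalIntegral.integral_comp_add_left (fun σ => a (linePt φ σ (coordPerp φ x))), add_zero,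
    ← intervalIntegral.integral_add_adjacent_intervals (b := ρ) (hc.intervalIntegrable _ _)
      (hc.intervalIntegrable _ _), lineFwd]
  rw [intervalIntegral.integral_congr (a := ρ) (g := fun _ => (0 : ℝ)),
    intervalIntegral.integral_zero, add_zero]
  intro σ hσ
  rw [uIcc_of_le (by linarith)] at hσ
  refine ha0 _ (le_trans ?_ (le_norm_linePt _ _ _))
  rw [abs_of_nonneg] <;> linarith [hσ.1, norm_nonneg x]

lemma radon_eq_integral (hρ : 0 ≤ ρ) (ha0 : ∀ x, ρ ≤ ‖x‖ → a x = 0) (φ s : ℝ) :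
    radon ρ a φ s = ∫ σ, a (linePt φ σ s) := by
  refine (integral_eq_intervalIntegral_of_eq_zero (by linarith) fun t ht => ?_).symm
  refine ha0 _ (le_trans ?_ (le_norm_linePt _ _ _))
  by_contra! h
  exact ht ⟨(abs_lt.mp h).1.le, (abs_lt.mp h).2.le⟩

lemma radon_eq_zero (ha0 : ∀ x, ρ ≤ ‖x‖ → a x = 0) (φ : ℝ) {s : ℝ} (hs : ρ ≤ |s|) :
    radon ρ a φ s = 0 := by
  rw [radon, intervalIntegral.integral_congr (g := fun _ => (0 : ℝ)),
    intervalIntegral.integral_zero]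
  intro σ _
  refine ha0 _ (hs.trans (abs_le_of_sq_le_sq ?_ (norm_nonneg _)))
  rw [norm_linePt_sq]
  nlinarith [sq_nonneg σ]

lemma abs_coordPerp_le (φ : ℝ) (x : ℂ) : |coordPerp φ x| ≤ ‖x‖ := by
  refine (Complex.abs_im_le_norm _).trans ?_
  simp

/-- The integrand of the Hilbert transform of the Radon transform, in Cartesian coordinates
centred at `x` and adapted to the direction `e^{iφ}`. -/
noncomputable def hilbertKernel (a : ℂ → ℝ) (φ : ℝ) (x : ℂ) (z : ℝ × ℝ) : ℝ :=
  (a (x - (z.1 + z.2 * I) * dir φ) - a (x - (z.1 - z.2 * I) * dir φ)) / z.2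

lemma measurable_hilbertKernel (ha : Continuous a) (φ : ℝ) (x : ℂ) :
    Measurable (hilbertKernel a φ x) := by
  refine Measurable.div (Continuous.measurable ?_) measurable_snd
  fun_prop

lemma abs_hilbertKernel_le {K : ℝ≥0} (ha : LipschitzWith K a) (φ : ℝ) (x : ℂ) (z : ℝ × ℝ) :
    ‖hilbertKernel a φ x z‖ ≤ 2 * K := by
  rw [hilbertKernel, Real.norm_eq_abs, abs_div]
  refine div_le_of_le_mul₀ (abs_nonneg _) (by positivity) ?_
  refine (ha.dist_le_mul _ _).trans (le_of_eq ?_)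
  rw [dist_eq_norm, show x - (z.1 + z.2 * I) * dir φ - (x - (z.1 - z.2 * I) * dir φ)
    = -((2 * z.2 : ℝ) * I * dir φ) by push_cast; ring]
  simp only [norm_neg, norm_mul, norm_I, mul_one, norm_dir, Complex.norm_real, Real.norm_eq_abs,
    abs_two]
  ring

lemma hilbertKernel_eq_zero (ha0 : ∀ x, ρ ≤ ‖x‖ → a x = 0) (φ : ℝ) {x : ℂ} (hx : ‖x‖ ≤ ρ)
    {z : ℝ × ℝ} (hz : (2 * ρ) ^ 2 ≤ z.1 ^ 2 + z.2 ^ 2) : hilbertKernel a φ x z = 0 := by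
  have hρ : 0 ≤ ρ := (norm_nonneg x).trans hx
  have h : ∀ y : ℂ, 2 * ρ ≤ ‖y‖ → a (x - y) = 0 := fun y hy => by
    refine ha0 _ ?_
    have := norm_sub_norm_le y x
    rw [norm_sub_rev] at this
    linarith
  have h1 : a (x - (z.1 + z.2 * I) * dir φ) = 0 := h _ <| by
    refine le_of_sq_le_sq ?_ (norm_nonneg _)
    have := norm_linePt_sq φ z.1 z.2
    rw [linePt] at this
    rw [this]; exact hz
  have h2 : a (x - (z.1 - z.2 * I) * dir φ) = 0 := h _ <| by
    refine le_of_sq_le_sq ?_ (norm_nonneg _)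
    have := norm_linePt_sq φ z.1 (-z.2)
    rw [linePt] at this
    push_cast at this
    rw [sub_eq_add_neg, ← neg_mul, this, neg_sq]; exact hz
  rw [hilbertKernel, h1, h2, sub_zero, zero_div]

lemma integrable_hilbertKernel {K : ℝ≥0} (ha : LipschitzWith K a)
    (ha0 : ∀ x, ρ ≤ ‖x‖ → a x = 0) (φ : ℝ) {x : ℂ} (hx : ‖x‖ ≤ ρ) :
    Integrable (hilbertKernel a φ x) := by
  have hρ : 0 ≤ ρ := (norm_nonneg x).trans hx
  rw [← integrableOn_iff_integrable_of_support_subset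
    (s := Metric.closedBall (0 : ℝ × ℝ) (2 * ρ))]
  · exact Measure.integrableOn_of_bounded (M := 2 * K) measure_closedBall_lt_top.ne
      (measurable_hilbertKernel ha.continuous φ x).aestronglyMeasurable
      (Eventually.of_forall fun z => abs_hilbertKernel_le ha φ x z)
  · intro z hz
    by_contra h
    refine hz (hilbertKernel_eq_zero ha0 φ hx ?_)
    rw [mem_closedBall_zero_iff, Prod.norm_def, max_le_iff, not_and_or, not_le, not_le,
      Real.norm_eq_abs, Real.norm_eq_abs] at h
    rcases h with h | h
    · have := sq_le_sq' (by linarith [abs_nonneg z.1]) h.le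
      rw [sq_abs] at this
      nlinarith [sq_nonneg z.2]
    · have := sq_le_sq' (by linarith [abs_nonneg z.2]) h.le
      rw [sq_abs] at this
      nlinarith [sq_nonneg z.1]

lemma hilbertRadon_eq_integral {K : ℝ≥0} (ha : LipschitzWith K a)
    (ha0 : ∀ x, ρ ≤ ‖x‖ → a x = 0) (φ : ℝ) {x : ℂ} (hx : ‖x‖ ≤ ρ) :
    hilbertRadon ρ a φ (coordPerp φ x) = ∫ z, hilbertKernel a φ x z := by
  have hρ : 0 ≤ ρ := (norm_nonneg x).trans hx
  have hs := abs_le.mp ((abs_coordPerp_le φ x).trans hx)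
  have hint := integrable_hilbertKernel ha ha0 φ hx
  rw [Measure.volume_eq_prod] at hint ⊢
  rw [integral_prod_symm _ hint, hilbertRadon, ← integral_eq_intervalIntegral_of_eq_zero
    (by linarith)]
  · refine integral_congr_ae (Eventually.of_forall fun q => ?_)
    have hci : ∀ s, Integrable fun p => a (linePt φ (coordPar φ x - p) s) := fun s => by
      refine Continuous.integrable_of_hasCompactSupport ?_ ?_
      · exact ha.continuous.comp (continuous_linePt.comp
          (f := fun p : ℝ => (φ, coordPar φ x - p, s)) (by fun_prop))
      · refine HasCompactSupport.intro (isCompact_Icc (a := coordPar φ x - ρ)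
          (b := coordPar φ x + ρ)) fun p hp => ha0 _ (le_trans ?_ (le_norm_linePt _ _ _))
        by_contra! h
        rw [abs_lt] at h
        exact hp ⟨by linarith, by linarith⟩
    have hk : ∀ p, hilbertKernel a φ x (p, q)
        = (a (linePt φ (coordPar φ x - p) (coordPerp φ x - q))
          - a (linePt φ (coordPar φ x - p) (coordPerp φ x + q))) / q := fun p => by
      have h1 := coord_sub_mul_dir φ x p q
      have h2 := coord_sub_mul_dir φ x p (-q)
      rw [sub_neg_eq_add] at h2
      rw [h1, h2, hilbertKernel]
      push_cast
      rw [neg_mul, ← sub_eq_add_neg]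
    simp only [hk]
    rw [integral_div, integral_sub (hci _) (hci _), radon_eq_integral hρ ha0,
      radon_eq_integral hρ ha0,
      integral_sub_left_eq_self (fun p => a (linePt φ p (coordPerp φ x - q))),
      integral_sub_left_eq_self (fun p => a (linePt φ p (coordPerp φ x + q)))]
  · intro t ht
    have ht' : 2 * ρ < |t| := by
      by_contra! h
      exact ht (abs_le.mp h)
    rw [radon_eq_zero ha0, radon_eq_zero ha0, sub_zero, zero_div]
    · rcases le_abs.mp ht'.le with h | h
      · exact le_abs.mpr (Or.inl (by linarith))
      · exact le_abs.mpr (Or.inr (by linarith))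
    · rcases le_abs.mp ht'.le with h | h
      · exact le_abs.mpr (Or.inr (by linarith))
      · exact le_abs.mpr (Or.inl (by linarith))

/-- In polar coordinates centred at `x` the Jacobian cancels the distance in the kernel. -/
lemma hilbertRadon_coord {K : ℝ≥0} (ha : LipschitzWith K a)
    (ha0 : ∀ x, ρ ≤ ‖x‖ → a x = 0) (φ : ℝ) {x : ℂ} (hx : ‖x‖ ≤ ρ) :
    hilbertRadon ρ a φ (coordPerp φ x) = ∫ z in Ioc 0 (2 * ρ) ×ˢ Ioo (-π) π,
      (a (x - z.1 * dir (φ + z.2)) - a (x - z.1 * dir (φ - z.2))) / Real.sin z.2 := by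
  have hρ : 0 ≤ ρ := (norm_nonneg x).trans hx
  rw [hilbertRadon_eq_integral ha ha0 φ hx, ← integral_comp_polarCoord_symm, polarCoord_target,
    setIntegral_eq_of_subset_of_forall_sdiff_eq_zero (s := Ioc 0 (2 * ρ) ×ˢ Ioo (-π) π)
      (measurableSet_Ioi.prod measurableSet_Ioo) (prod_mono_left Ioc_subset_Ioi_self)]
  · refine setIntegral_congr_fun (measurableSet_Ioc.prod measurableSet_Ioo) fun z hz => ?_
    have hz0 : z.1 ≠ 0 := hz.1.1.ne'
    simp only [polarCoord_symm_apply, hilbertKernel, smul_eq_mul]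
    rw [dir_add, sub_eq_add_neg φ, dir_add, dir_eq z.2, dir_eq (-z.2), Real.cos_neg, Real.sin_neg,
      ← mul_div_assoc, mul_div_mul_left _ _ hz0]
    push_cast
    ring_nf
  · intro z hz
    rw [polarCoord_symm_apply, hilbertKernel_eq_zero ha0 φ hx, smul_zero]
    have h1 : 2 * ρ < z.1 := by
      by_contra! h
      exact hz.2 ⟨⟨hz.1.1, h⟩, hz.1.2⟩
    have h2 : (z.1 * Real.cos z.2) ^ 2 + (z.1 * Real.sin z.2) ^ 2 = z.1 ^ 2 := by
      rw [mul_pow, mul_pow, ← mul_add, Real.cos_sq_add_sin_sq, mul_one]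
    simp only [h2]
    exact pow_le_pow_left₀ (by positivity) h1.le 2

lemma angMode_beam (ha : Continuous a) (x : ℂ) (m : ℤ) :
    angMode m (fun φ => ((∫ r in (0 : ℝ)..2 * ρ, a (x - r * dir φ) : ℝ) : ℂ))
      = ∫ r in (0 : ℝ)..2 * ρ, angMode m (fun φ => (a (x - r * dir φ) : ℂ)) := by
  simp only [angMode, ← intervalIntegral.integral_ofReal, ← intervalIntegral.integral_const_mul]
  refine intervalIntegral_intervalIntegral_swap ?_
  have hc : Continuous (Function.uncurry fun (φ r : ℝ) =>
      cexp (-(m * φ * I)) * (a (x - r * dir φ) : ℂ)) := by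
    simp only [Function.uncurry_def]
    fun_prop
  exact (hc.continuousOn.integrableOn_compact (isCompact_uIcc.prod isCompact_uIcc)).mono_set
    (prod_mono uIoc_subset_uIcc uIoc_subset_uIcc)

lemma dir_sub_two_pi_periodic (x : ℂ) (r : ℝ) :
    Function.Periodic (fun φ => (a (x - r * dir φ) : ℂ)) (2 * π) := fun φ => by
  simp only [dir_add_two_pi]

lemma angMode_hilbert {K : ℝ≥0} (hρ : 0 ≤ ρ) (ha : LipschitzWith K a) (x : ℂ) (k : ℕ) :
    angMode (-k) (fun φ => ((∫ z in Ioc 0 (2 * ρ) ×ˢ Ioo (-π) π,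
      (a (x - z.1 * dir (φ + z.2)) - a (x - z.1 * dir (φ - z.2))) / Real.sin z.2 : ℝ) : ℂ))
      = -(2 * π * I) * (1 - (-1) ^ k) *
        ∫ r in (0 : ℝ)..2 * ρ, angMode (-k) (fun φ => (a (x - r * dir φ) : ℂ)) := by
  have hac := ha.continuous
  have h1 : ∀ φ : ℝ, ((∫ z in Ioc 0 (2 * ρ) ×ˢ Ioo (-π) π,
      (a (x - z.1 * dir (φ + z.2)) - a (x - z.1 * dir (φ - z.2))) / Real.sin z.2 : ℝ) : ℂ)
      = ∫ z in Ioc 0 (2 * ρ) ×ˢ Ioo (-π) π, (((a (x - z.1 * dir (φ + z.2))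
        - a (x - z.1 * dir (φ - z.2))) / Real.sin z.2 : ℝ) : ℂ) := fun φ => integral_ofReal.symm
  simp only [h1]
  rw [angMode]
  simp only [← integral_const_mul]
  rw [intervalIntegral_integral_swap]
  · have h2 : ∀ z : ℝ × ℝ, ∫ φ in (0 : ℝ)..2 * π, cexp (-(((-k : ℤ) : ℂ) * φ * I)) *
        (((a (x - z.1 * dir (φ + z.2)) - a (x - z.1 * dir (φ - z.2))) / Real.sin z.2 : ℝ) : ℂ)
        = angMode (-k) (fun φ => (a (x - z.1 * dir φ) : ℂ)) *
          ((cexp (-(k * z.2 * I)) - cexp (k * z.2 * I)) / Real.sin z.2) := by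
      intro z
      have s1 := angMode_shift (dir_sub_two_pi_periodic (a := a) x z.1) (-k) z.2
      have s2 := angMode_shift (dir_sub_two_pi_periodic (a := a) x z.1) (-k) (-z.2)
      rw [show ∀ A B C D : ℂ, A * ((B - C) / D) = (B * A - C * A) / D by intros; ring]
      have e1 : cexp (((-k : ℤ) : ℂ) * (z.2 : ℝ) * I) = cexp (-(k * z.2 * I)) := by
        congr 1; push_cast; ring
      have e2 : cexp (((-k : ℤ) : ℂ) * ((-z.2 : ℝ) : ℂ) * I) = cexp (k * z.2 * I) := by
        congr 1; push_cast; ring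
      rw [e1] at s1
      rw [e2] at s2
      rw [← s1, ← s2, angMode, angMode, ← intervalIntegral.integral_sub,
        ← intervalIntegral.integral_div]
      · refine intervalIntegral.integral_congr fun φ _ => ?_
        simp only [← sub_eq_add_neg]
        push_cast
        ring
      · exact Continuous.intervalIntegrable (by fun_prop) _ _
      · exact Continuous.intervalIntegrable (by fun_prop) _ _
    simp only [h2]
    rw [Measure.volume_eq_prod, setIntegral_prod_mul
      (fun r : ℝ => angMode (-k) (fun φ => (a (x - r * dir φ) : ℂ)))
      (fun β : ℝ => (cexp (-(k * β * I)) - cexp (k * β * I)) / Real.sin β),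
      integral_cexp_sub_div_sin, intervalIntegral.integral_of_le (by positivity), mul_comm]
  · rw [Measure.prod_restrict]
    have hlt : (volume.prod volume) (uIoc 0 (2 * π) ×ˢ (Ioc 0 (2 * ρ) ×ˢ Ioo (-π) π)) < ⊤ := by
      refine lt_of_le_of_lt (measure_mono (prod_mono uIoc_subset_uIcc
        (prod_mono Ioc_subset_Icc_self Ioo_subset_Icc_self)))
        (isCompact_uIcc.prod (isCompact_Icc.prod isCompact_Icc)).measure_lt_top
    refine Measure.integrableOn_of_bounded (M := 2 * ρ * K * 2) hlt.ne ?_ ?_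
    · refine Measurable.aestronglyMeasurable ?_
      simp only [Function.uncurry_def]
      refine Measurable.mul (Continuous.measurable (by fun_prop)) (measurable_ofReal.comp ?_)
      exact Measurable.div (Continuous.measurable (by fun_prop))
        (Continuous.measurable (by fun_prop))
    · refine (ae_restrict_mem (measurableSet_uIoc.prod
        (measurableSet_Ioc.prod measurableSet_Ioo))).mono fun z hz => ?_
      have hr : |z.2.1| ≤ 2 * ρ := by
        rw [abs_of_pos hz.2.1.1]; exact hz.2.1.2
      simp only [Function.uncurry_def]
      rw [norm_mul, show -(((-k : ℤ) : ℂ) * z.1 * I) = ((k * z.1 : ℝ) : ℂ) * I by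
        push_cast; ring, Complex.norm_exp_ofReal_mul_I, one_mul, Complex.norm_real,
        Real.norm_eq_abs, abs_div]
      refine div_le_of_le_mul₀ (abs_nonneg _) (by positivity) ?_
      refine (ha.dist_le_mul _ _).trans ?_
      rw [dist_eq_norm, show x - z.2.1 * dir (z.1 + z.2.2) - (x - z.2.1 * dir (z.1 - z.2.2))
        = -((z.2.1 : ℝ) * ((2 * Real.sin z.2.2 : ℝ) : ℂ) * I * dir z.1) by
          rw [dir_add, sub_eq_add_neg z.1, dir_add, dir_eq z.2.2, dir_eq (-z.2.2), Real.cos_neg,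
            Real.sin_neg]
          push_cast
          ring]
      simp only [norm_neg, norm_mul, norm_I, mul_one, norm_dir, Complex.norm_real,
        Real.norm_eq_abs, abs_two]
      calc (K : ℝ) * (|z.2.1| * (2 * |Real.sin z.2.2|))
          ≤ K * (2 * ρ * (2 * |Real.sin z.2.2|)) := by gcongr
        _ = _ := by ring

/-- The forward and backward integrals contribute the odd part of the beam transform, the Hilbert
transform minus its negative modes. -/
lemma angMode_holExponent {K : ℝ≥0} (ha : LipschitzWith K a) (ha0 : ∀ x, ρ ≤ ‖x‖ → a x = 0)
    {x : ℂ} (hx : ‖x‖ ≤ ρ) (k : ℕ) : angMode (-k) (fun φ => holExponent ρ a φ x) = 0 := by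
  have hρ : 0 ≤ ρ := (norm_nonneg x).trans hx
  have hac := ha.continuous
  set b : ℝ → ℂ := fun φ => ((∫ r in (0 : ℝ)..2 * ρ, a (x - r * dir φ) : ℝ) : ℂ) with hb
  have hbc : Continuous b := by
    refine continuous_ofReal.comp
      (intervalIntegral.continuous_parametric_intervalIntegral_of_continuous'
        (f := fun φ r => a (x - r * dir φ)) ?_ _ _)
    simp only [Function.uncurry_def]
    fun_prop
  have hbp : Function.Periodic b (2 * π) := fun φ => by simp only [hb, dir_add_two_pi]
  have hH : Continuous fun φ => (hilbertRadon ρ a φ (coordPerp φ x) : ℂ) :=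
    continuous_ofReal.comp ((continuous_hilbertRadon hρ ha).comp
      (f := fun φ : ℝ => (φ, coordPerp φ x)) (by fun_prop))
  have h1 : ∀ φ, holExponent ρ a φ x = (b φ - b (φ + π)) / 2
      - I / (4 * π) * (hilbertRadon ρ a φ (coordPerp φ x) : ℝ) := fun φ => by
    rw [holExponent, lineBwd_coord hac ha0 φ hx, lineFwd_coord hac ha0 φ hx]
    simp only [hb, dir_add_pi]
    push_cast
    simp only [mul_neg, sub_neg_eq_add]
  have h2 : angMode (-k) (fun φ => holExponent ρ a φ x)
      = (angMode (-k) b - angMode (-k) (fun φ => b (φ + π))) / 2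
        - I / (4 * π) * angMode (-k) (fun φ => (hilbertRadon ρ a φ (coordPerp φ x) : ℂ)) := by
    simp only [h1, angMode]
    rw [← intervalIntegral.integral_sub, ← intervalIntegral.integral_div,
      ← intervalIntegral.integral_const_mul, ← intervalIntegral.integral_sub]
    · refine intervalIntegral.integral_congr fun φ _ => ?_
      ring
    all_goals exact Continuous.intervalIntegrable (by fun_prop) _ _
  rw [h2, angMode_shift hbp]
  simp only [hilbertRadon_coord ha ha0 _ hx]
  rw [angMode_hilbert hρ ha, hb, angMode_beam hac,
    show cexp (((-k : ℤ) : ℂ) * (π : ℝ) * I) = (-1) ^ k by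
      rw [show ((-k : ℤ) : ℂ) * (π : ℝ) * I = k * (-(π * I)) by push_cast; ring,
        Complex.exp_nat_mul, Complex.exp_neg, Complex.exp_pi_mul_I]
      norm_num]
  have hpi : (π : ℂ) ≠ 0 := by simp [Real.pi_ne_zero]
  field_simp
  ring_nf
  simp only [I_sq]
  ring

lemma isHardy_holExponent {K : ℝ≥0} (ha : LipschitzWith K a) (ha0 : ∀ x, ρ ≤ ‖x‖ → a x = 0)
    {x : ℂ} (hx : ‖x‖ ≤ ρ) : IsHardy (fun φ => holExponent ρ a φ x) := by
  refine ⟨(continuous_holExponent ((norm_nonneg x).trans hx) ha).comp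
    (f := fun φ : ℝ => (φ, x)) (by fun_prop), holExponent_periodic x, fun m hm => ?_⟩
  obtain ⟨k, rfl⟩ : ∃ k : ℕ, m = -k := ⟨m.natAbs, by omega⟩
  exact angMode_holExponent ha ha0 hx k

end Modes

/-! ### Compactly supported solutions of the transport equation -/

section FourierRigidity

variable {ρ : ℝ} {v g : ℝ → ℂ → ℂ}

lemma continuous_planeWave (ξ : ℂ) :
    Continuous fun x : ℂ => cexp (((-2 * π * inner ℝ x ξ : ℝ) : ℂ) * I) := by
  fun_prop

lemma fourier_eq_setIntegral {f : ℂ → ℂ} (h0 : ∀ x, ρ ≤ ‖x‖ → f x = 0) (ξ : ℂ) :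
    𝓕 f ξ = ∫ x in Metric.closedBall (0 : ℂ) ρ,
      cexp (((-2 * π * inner ℝ x ξ : ℝ) : ℂ) * I) * f x := by
  rw [Real.fourier_eq', setIntegral_eq_integral_of_forall_compl_eq_zero]
  · rfl
  · intro x hx
    rw [mem_closedBall_zero_iff, not_le] at hx
    rw [h0 x hx.le, mul_zero]

lemma continuous_fourier_parametric (hv : Continuous (Function.uncurry v))
    (h0 : ∀ φ x, ρ ≤ ‖x‖ → v φ x = 0) (ξ : ℂ) : Continuous fun φ => 𝓕 (v φ) ξ := by
  simp only [fun φ => fourier_eq_setIntegral (h0 φ) ξ]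
  refine continuous_parametric_integral_of_continuous
    (f := fun φ x => cexp (((-2 * π * inner ℝ x ξ : ℝ) : ℂ) * I) * v φ x) ?_
    (isCompact_closedBall 0 ρ)
  exact ((continuous_planeWave ξ).comp continuous_snd).mul hv

lemma continuous_angMode (hv : Continuous (Function.uncurry v)) (m : ℤ) :
    Continuous fun x => angMode m (fun φ => v φ x) := by
  refine intervalIntegral.continuous_parametric_intervalIntegral_of_continuous'
    (f := fun x φ => cexp (-(m * φ * I)) * v φ x) ?_ _ _
  exact Continuous.mul (by fun_prop) (hv.comp continuous_swap)

lemma angMode_zero (m : ℤ) : angMode m (fun _ => 0) = 0 := by simp [angMode]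

lemma angMode_fourier (hv : Continuous (Function.uncurry v))
    (h0 : ∀ φ x, ρ ≤ ‖x‖ → v φ x = 0) (m : ℤ) (ξ : ℂ) :
    angMode m (fun φ => 𝓕 (v φ) ξ) = 𝓕 (fun x => angMode m (fun φ => v φ x)) ξ := by
  rw [fourier_eq_setIntegral (ρ := ρ) (fun x hx => by simp only [h0 _ x hx, angMode_zero])]
  simp only [fun φ => fourier_eq_setIntegral (h0 φ) ξ, angMode]
  simp only [← integral_const_mul, ← intervalIntegral.integral_const_mul]
  rw [intervalIntegral_integral_swap]
  · refine integral_congr_ae (Eventually.of_forall fun x => ?_)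
    refine intervalIntegral.integral_congr fun φ _ => ?_
    ring
  · rw [Measure.prod_restrict]
    refine IntegrableOn.mono_set (t := uIcc 0 (2 * π) ×ˢ Metric.closedBall 0 ρ) ?_
      (prod_mono uIoc_subset_uIcc subset_rfl)
    refine Continuous.continuousOn ?_ |>.integrableOn_compact
      (isCompact_uIcc.prod (isCompact_closedBall 0 ρ))
    simp only [Function.uncurry_def]
    refine Continuous.mul (by fun_prop) (Continuous.mul ?_ hv)
    exact (continuous_planeWave ξ).comp continuous_snd

lemma integrable_of_eq_zero {f : ℂ → ℂ} (hf : Continuous f) (h0 : ∀ x, ρ ≤ ‖x‖ → f x = 0) :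
    Integrable f :=
  hf.integrable_of_hasCompactSupport <| HasCompactSupport.intro (isCompact_closedBall 0 ρ)
    fun x hx => h0 x (by rw [mem_closedBall_zero_iff, not_le] at hx; exact hx.le)

lemma fourier_lineDeriv {f f' : ℂ → ℂ} (hf : Continuous f) (hf' : Continuous f')
    (h0 : ∀ x, ρ ≤ ‖x‖ → f x = 0) (h0' : ∀ x, ρ ≤ ‖x‖ → f' x = 0) (θ : ℂ)
    (hd : ∀ x, HasLineDerivAt ℝ f (f' x) x θ) (ξ : ℂ) :
    𝓕 f' ξ = 2 * π * I * (inner ℝ θ ξ : ℝ) * 𝓕 f ξ := by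
  set e : ℂ → ℂ := fun x => cexp (((-2 * π * inner ℝ x ξ : ℝ) : ℂ) * I) with he
  have hec : Continuous e := continuous_planeWave ξ
  set c : ℂ := -(2 * π * I * (inner ℝ θ ξ : ℝ)) with hc
  have hed : ∀ x, HasLineDerivAt ℝ e (c * e x) x θ := by
    intro x
    have h1 : HasDerivAt (fun t : ℝ => ((-2 * π * (inner ℝ x ξ + t * inner ℝ θ ξ) : ℝ) : ℂ) * I)
        (((-2 * π * (1 * inner ℝ θ ξ) : ℝ) : ℂ) * I) 0 :=
      (((((hasDerivAt_id (0 : ℝ)).mul_const (inner ℝ θ ξ : ℝ)).const_add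
        (inner ℝ x ξ : ℝ)).const_mul (-2 * π)).ofReal_comp).mul_const I
    have h2 := h1.cexp
    simp only [HasLineDerivAt, he, inner_add_left, real_inner_smul_left]
    refine h2.congr_deriv ?_
    simp only [zero_mul, add_zero, one_mul, hc]
    push_cast
    ring
  have hi := integral_bilinear_hasLineDerivAt_right_eq_neg_left_of_integrable
    (μ := (volume : Measure ℂ)) (f := f) (f' := f') (g := e) (g' := fun x => c * e x) (v := θ)
    (B := ContinuousLinearMap.mul ℝ ℂ)
    (integrable_of_eq_zero (ρ := ρ) (by simp only [ContinuousLinearMap.mul_apply']; fun_prop)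
      fun x hx => by simp [h0' x hx])
    (integrable_of_eq_zero (ρ := ρ) (by simp only [ContinuousLinearMap.mul_apply']; fun_prop)
      fun x hx => by simp [h0 x hx])
    (integrable_of_eq_zero (ρ := ρ) (by simp only [ContinuousLinearMap.mul_apply']; fun_prop)
      fun x hx => by simp [h0 x hx])
    (fun x _ => hd x) (fun x _ => hed x)
  simp only [ContinuousLinearMap.mul_apply'] at hi
  rw [Real.fourier_eq', Real.fourier_eq']
  simp only [smul_eq_mul]
  have h3 : ∫ x, f x * (c * e x) = c * ∫ x, e x * f x := by
    rw [← integral_const_mul]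
    exact integral_congr_ae (Eventually.of_forall fun x => by ring)
  have h4 : ∫ x, f' x * e x = ∫ x, e x * f' x :=
    integral_congr_ae (Eventually.of_forall fun x => by ring)
  rw [h3, h4] at hi
  rw [eq_comm, ← neg_inj, ← neg_mul, ← hc, hi]

lemma angMode_dir_mul (m : ℤ) (f : ℝ → ℂ) :
    angMode m (fun φ => dir φ * f φ) = angMode (m - 1) f := by
  refine intervalIntegral.integral_congr fun φ _ => ?_
  simp only [dir]
  rw [← mul_assoc, ← Complex.exp_add]
  congr 2
  push_cast
  ring

lemma angMode_conj_dir_mul (m : ℤ) (f : ℝ → ℂ) :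
    angMode m (fun φ => conj (dir φ) * f φ) = angMode (m + 1) f := by
  refine intervalIntegral.integral_congr fun φ _ => ?_
  simp only [dir, ← Complex.exp_conj, map_mul, conj_ofReal, conj_I]
  rw [← mul_assoc, ← Complex.exp_add]
  congr 2
  push_cast
  ring

lemma angMode_add {f h : ℝ → ℂ} (hf : Continuous f) (hh : Continuous h) (m : ℤ) :
    angMode m (fun φ => f φ + h φ) = angMode m f + angMode m h := by
  rw [angMode, angMode, angMode, ← intervalIntegral.integral_add]
  · simp only [mul_add]
  all_goals exact Continuous.intervalIntegrable (by fun_prop) _ _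

lemma angMode_const_mul (c : ℂ) (f : ℝ → ℂ) (m : ℤ) :
    angMode m (fun φ => c * f φ) = c * angMode m f := by
  rw [angMode, angMode, ← intervalIntegral.integral_const_mul]
  refine intervalIntegral.integral_congr fun φ _ => ?_
  ring

/-- Let `θ · ∇v = g` with `v` and `g` compactly supported. If the modes of `g` of order at most
`-2` vanish, so do the negative modes of `v`: the Fourier transform in `x` turns the equation into
`conj ξ • V_{m-1} + ξ • V_{m+1} = 0` for `m ≤ -2`, so `|V_n| = |V_{n-2}| = ⋯` for `n < 0`, and the
modes of a continuous function tend to zero. -/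
theorem angMode_eq_zero_of_lineDeriv (hv : Continuous (Function.uncurry v))
    (hg : Continuous (Function.uncurry g)) (hvp : ∀ x, Function.Periodic (fun φ => v φ x) (2 * π))
    (hv0 : ∀ φ x, ρ ≤ ‖x‖ → v φ x = 0) (hg0 : ∀ φ x, ρ ≤ ‖x‖ → g φ x = 0)
    (hd : ∀ φ x, HasLineDerivAt ℝ (v φ) (g φ x) x (dir φ))
    (hm : ∀ x, ∀ m : ℤ, m ≤ -2 → angMode m (fun φ => g φ x) = 0) (x : ℂ) {n : ℤ} (hn : n < 0) :
    angMode n (fun φ => v φ x) = 0 := by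
  have hvc : ∀ φ, Continuous (v φ) := fun φ => hv.comp (f := fun x => (φ, x)) (by fun_prop)
  have hgc : ∀ φ, Continuous (g φ) := fun φ => hg.comp (f := fun x => (φ, x)) (by fun_prop)
  have key : ∀ ξ : ℂ, ξ ≠ 0 → ∀ n : ℤ, n < 0 → angMode n (fun φ => 𝓕 (v φ) ξ) = 0 := by
    intro ξ hξ
    set V : ℝ → ℂ := fun φ => 𝓕 (v φ) ξ with hV
    have hVc : Continuous V := continuous_fourier_parametric hv hv0 ξ
    have hVp : Function.Periodic V (2 * π) := fun φ => by
      have : v (φ + 2 * π) = v φ := funext fun x => hvp x φ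
      simp only [hV, this]
    have hrec : ∀ m : ℤ, m ≤ -2 → ξ * angMode (m + 1) V + conj ξ * angMode (m - 1) V = 0 := by
      intro m hm2
      have h1 := angMode_fourier hg hg0 m ξ
      have h2 : (fun x => angMode m (fun φ => g φ x)) = fun _ => 0 := funext fun x => hm x m hm2
      have h3 : ∀ φ, 𝓕 (g φ) ξ
          = π * I * (ξ * (conj (dir φ) * V φ) + conj ξ * (dir φ * V φ)) := fun φ => by
        rw [fourier_lineDeriv (hvc φ) (hgc φ) (hv0 φ) (hg0 φ) (dir φ) (hd φ) ξ, Complex.inner,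
          Complex.re_eq_add_conj]
        simp only [map_mul, conj_conj]
        ring
      rw [h2, Real.fourier_eq'] at h1
      simp only [smul_zero, integral_zero, h3] at h1
      rw [angMode_const_mul, angMode_add (by fun_prop) (by fun_prop), angMode_const_mul,
        angMode_const_mul, angMode_dir_mul, angMode_conj_dir_mul] at h1
      exact (mul_eq_zero.mp h1).resolve_left (by simp [Real.pi_ne_zero])
    have hstep : ∀ n : ℤ, n < 0 → ‖angMode n V‖ = ‖angMode (n - 2) V‖ := by
      intro n hn
      have := hrec (n - 1) (by omega)
      rw [sub_add_cancel, show n - 1 - 1 = n - 2 by ring] at this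
      have h := congrArg norm (eq_neg_of_add_eq_zero_left this)
      rw [norm_neg, norm_mul, norm_mul, Complex.norm_conj] at h
      exact mul_left_cancel₀ (norm_ne_zero_iff.mpr hξ) h
    intro n hn
    have hall : ∀ j : ℕ, ‖angMode (n - 2 * j) V‖ = ‖angMode n V‖ := by
      intro j
      induction j with
      | zero => simp
      | succ j ih =>
        rw [← ih, hstep (n - 2 * j) (by omega)]
        congr 2
        push_cast
        ring
    have hlim : Tendsto (fun j : ℕ => n - 2 * (j : ℤ)) atTop atBot := by
      refine tendsto_atBot.mpr fun b => ?_
      filter_upwards [eventually_ge_atTop (n - b).natAbs] with j hj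
      omega
    have h0 := ((tendsto_angMode_atBot hVc hVp).comp hlim).norm
    simp only [Function.comp_def, hall, norm_zero] at h0
    exact norm_eq_zero.mp (tendsto_nhds_unique tendsto_const_nhds h0)
  set f : ℂ → ℂ := fun x => angMode n (fun φ => v φ x) with hf
  have hfc : Continuous f := continuous_angMode hv n
  have hf0 : ∀ x, ρ ≤ ‖x‖ → f x = 0 := fun x hx => by
    simp only [hf, hv0 _ x hx, angMode_zero]
  have hF : 𝓕 f =ᵐ[volume] 0 := by
    filter_upwards [Measure.ae_ne volume (0 : ℂ)] with ξ hξ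
    rw [hf, ← angMode_fourier hv hv0 n ξ]
    exact key ξ hξ n hn
  have hinv := hfc.fourierInv_fourier_eq (integrable_of_eq_zero hfc hf0)
    ((integrable_zero _ _ _).congr hF.symm)
  have hx := congrFun hinv x
  rw [Real.fourierInv_eq', integral_congr_ae (g := fun _ => 0)
    (hF.mono fun ξ hξ => by simp [hξ]), integral_zero] at hx
  exact hx.symm

end FourierRigidity

/-! ### The kernel of the attenuated transform -/

/-- The source `f - θ · F` with `θ = e^{iφ}`. -/
noncomputable def raySource (f : ℂ → ℝ) (F : ℂ → ℂ) (φ : ℝ) (x : ℂ) : ℝ :=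
  f x - (F x * conj (dir φ)).re

/-- The solution, vanishing after the last point of the line in the disc of radius `ρ`, of
`θ · ∇u + a u = -h`. -/
noncomputable def transportSol (ρ : ℝ) (a : ℂ → ℝ) (h : ℝ → ℂ → ℝ) (φ : ℝ) (x : ℂ) : ℝ :=
  Real.exp (lineFwd ρ a φ (coordPar φ x) (coordPerp φ x)) *
    ∫ σ in (coordPar φ x)..ρ, h φ (linePt φ σ (coordPerp φ x)) *
      Real.exp (-lineFwd ρ a φ σ (coordPerp φ x))

section Transport

variable {ρ : ℝ} {a : ℂ → ℝ} {h : ℝ → ℂ → ℝ}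

lemma continuous_transport_integrand (ha : Continuous a) (hh : Continuous (Function.uncurry h)) :
    Continuous fun z : ℝ × ℝ × ℝ =>
      h z.1 (linePt z.1 z.2.1 z.2.2) * Real.exp (-lineFwd ρ a z.1 z.2.1 z.2.2) :=
  (hh.comp (continuous_fst.prodMk continuous_linePt)).mul
    (Real.continuous_exp.comp (continuous_lineFwd ha).neg)

lemma continuous_transportSol (ha : Continuous a) (hh : Continuous (Function.uncurry h)) :
    Continuous fun z : ℝ × ℂ => transportSol ρ a h z.1 z.2 := by
  have hc := continuous_transport_integrand (ρ := ρ) ha hh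
  refine Continuous.mul (Real.continuous_exp.comp ((continuous_lineFwd (ρ := ρ) ha).comp
    (f := fun z : ℝ × ℂ => (z.1, coordPar z.1 z.2, coordPerp z.1 z.2)) (by fun_prop))) ?_
  simp only [intervalIntegral.integral_symm ρ]
  refine (intervalIntegral.continuous_parametric_intervalIntegral_of_continuous
    (f := fun (z : ℝ × ℂ) σ => h z.1 (linePt z.1 σ (coordPerp z.1 z.2)) *
      Real.exp (-lineFwd ρ a z.1 σ (coordPerp z.1 z.2))) ?_ (by fun_prop)).neg
  exact hc.comp (f := fun z : (ℝ × ℂ) × ℝ => (z.1.1, z.2, coordPerp z.1.1 z.1.2)) (by fun_prop)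

lemma transportSol_periodic (hp : ∀ x, Function.Periodic (fun φ => h φ x) (2 * π)) (x : ℂ) :
    Function.Periodic (fun φ => transportSol ρ a h φ x) (2 * π) := by
  intro φ
  have : h (φ + 2 * π) = h φ := funext fun y => hp y φ
  simp only [transportSol, coordPar, coordPerp, dir_add_two_pi, lineFwd, linePt_add_two_pi, this]

lemma hasDerivAt_transportSol (ha : Continuous a) (hh : Continuous (Function.uncurry h)) (φ : ℝ)
    (x : ℂ) : HasDerivAt (fun t : ℝ => transportSol ρ a h φ (x + t * dir φ))
      (-(a x * transportSol ρ a h φ x) - h φ x) 0 := by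
  simp only [transportSol, coordPar_add, coordPerp_add]
  set p := coordPar φ x
  set s := coordPerp φ x
  have hc : Continuous fun σ => h φ (linePt φ σ s) * Real.exp (-lineFwd ρ a φ σ s) :=
    (continuous_transport_integrand (ρ := ρ) ha hh).comp (f := fun σ : ℝ => (φ, σ, s))
      (by fun_prop)
  have h1 := ((hasDerivAt_lineFwd (ρ := ρ) ha φ (p + 0) s).comp_const_add p 0).exp
  have h2 : HasDerivAt (fun p => ∫ σ in p..ρ, h φ (linePt φ σ s) *
      Real.exp (-lineFwd ρ a φ σ s)) _ (p + 0) :=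
    intervalIntegral.integral_hasDerivAt_left (hc.intervalIntegrable _ _)
      (hc.stronglyMeasurableAtFilter _ _) hc.continuousAt
  have h3 := h1.mul (h2.comp_const_add p 0)
  refine h3.congr_deriv ?_
  have hx : linePt φ p s = x := linePt_coord φ x
  rw [add_zero, hx, Real.exp_neg]
  field_simp
  ring

/-- Beyond the disc the solution vanishes trivially, before the disc because the data vanish. -/
lemma transportSol_eq_zero (ha : Continuous a) (hh : Continuous (Function.uncurry h))
    (h0 : ∀ φ x, ρ ≤ ‖x‖ → h φ x = 0)
    (hdata : ∀ φ s, ∫ σ in (-ρ)..ρ, h φ (linePt φ σ s) * Real.exp (-lineFwd ρ a φ σ s) = 0)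
    (φ : ℝ) {x : ℂ} (hx : ρ ≤ ‖x‖) (hρ : 0 ≤ ρ) : transportSol ρ a h φ x = 0 := by
  rw [transportSol]
  have hxp := norm_linePt_sq φ (coordPar φ x) (coordPerp φ x)
  rw [linePt_coord] at hxp
  set p := coordPar φ x
  set s := coordPerp φ x
  have hc : Continuous fun σ => h φ (linePt φ σ s) * Real.exp (-lineFwd ρ a φ σ s) :=
    (continuous_transport_integrand (ρ := ρ) ha hh).comp (f := fun σ : ℝ => (φ, σ, s))
      (by fun_prop)
  have hz : ∀ σ : ℝ, p ^ 2 ≤ σ ^ 2 ∨ ρ ^ 2 ≤ σ ^ 2 →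
      h φ (linePt φ σ s) * Real.exp (-lineFwd ρ a φ σ s) = 0 := by
    intro σ hσ
    rw [h0, zero_mul]
    refine le_of_sq_le_sq ?_ (norm_nonneg _)
    rw [norm_linePt_sq]
    have : ρ ^ 2 ≤ ‖x‖ ^ 2 := pow_le_pow_left₀ hρ hx 2
    rcases hσ with hσ | hσ <;> nlinarith [sq_nonneg s]
  refine mul_eq_zero_of_right _ ?_
  rcases le_total 0 p with hp | hp
  · rw [intervalIntegral.integral_congr (g := fun _ => (0 : ℝ)), intervalIntegral.integral_zero]
    intro σ hσ
    refine hz σ ?_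
    rcases le_total p ρ with h' | h'
    · rw [uIcc_of_le h'] at hσ
      exact Or.inl (pow_le_pow_left₀ hp hσ.1 2)
    · rw [uIcc_of_ge h'] at hσ
      exact Or.inr (pow_le_pow_left₀ hρ hσ.1 2)
  · have h1 := intervalIntegral.integral_add_adjacent_intervals (hc.intervalIntegrable (-ρ) p)
      (hc.intervalIntegrable p ρ) (μ := volume)
    rw [hdata, intervalIntegral.integral_congr (b := p) (g := fun _ => (0 : ℝ)),
      intervalIntegral.integral_zero, zero_add] at h1
    · exact h1
    · intro σ hσ
      refine hz σ ?_
      rcases le_total (-ρ) p with h' | h'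
      · rw [uIcc_of_le h'] at hσ
        exact Or.inl (by nlinarith [hσ.2])
      · rw [uIcc_of_ge h'] at hσ
        exact Or.inr (by nlinarith [hσ.2])

end Transport

section Potential

variable {ρ : ℝ} {a f : ℂ → ℝ} {F : ℂ → ℂ}

lemma continuous_raySource (hf : Continuous f) (hF : Continuous F) :
    Continuous (Function.uncurry (raySource f F)) := by
  simp only [Function.uncurry_def, raySource]
  fun_prop

lemma angMode_mul_raySource {E : ℝ → ℂ} (hE : IsHardy E) (x : ℂ) {m : ℤ} (hm : m ≤ -2) :
    angMode m (fun φ => E φ * (raySource f F φ x : ℂ)) = 0 := by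
  have hEc := hE.continuous
  have h1 : ∀ φ, E φ * (raySource f F φ x : ℂ) = (f x : ℂ) * E φ
      + (-(F x / 2) * (conj (dir φ) * E φ) + -(conj (F x) / 2) * (dir φ * E φ)) := fun φ => by
    rw [raySource, ofReal_sub, Complex.re_eq_add_conj]
    simp only [map_mul, conj_conj]
    ring
  simp only [h1]
  rw [angMode_add (by fun_prop) (by fun_prop), angMode_add (by fun_prop) (by fun_prop),
    angMode_const_mul, angMode_const_mul, angMode_const_mul, angMode_dir_mul,
    angMode_conj_dir_mul, hE.angMode_eq_zero _ (by omega), hE.angMode_eq_zero _ (by omega),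
    hE.angMode_eq_zero _ (by omega)]
  ring

/-- If the attenuated transform of `f - θ · F` vanishes, the solution of the transport equation
does not depend on the direction. -/
theorem transportSol_eq_of_data {K : ℝ≥0} (hρ : 0 ≤ ρ) (ha : LipschitzWith K a)
    (ha0 : ∀ x, ρ ≤ ‖x‖ → a x = 0) (hf : Continuous f) (hf0 : ∀ x, ρ ≤ ‖x‖ → f x = 0)
    (hF : Continuous F) (hF0 : ∀ x, ρ ≤ ‖x‖ → F x = 0)
    (hdata : ∀ φ s, ∫ σ in (-ρ)..ρ, raySource f F φ (linePt φ σ s) *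
      Real.exp (-lineFwd ρ a φ σ s) = 0) (φ ψ : ℝ) (x : ℂ) :
    transportSol ρ a (raySource f F) φ x = transportSol ρ a (raySource f F) ψ x := by
  have hac := ha.continuous
  have hh := continuous_raySource hf hF
  have hh0 : ∀ φ x, ρ ≤ ‖x‖ → raySource f F φ x = 0 := fun φ x hx => by
    simp [raySource, hf0 x hx, hF0 x hx]
  have hhp : ∀ x, Function.Periodic (fun φ => raySource f F φ x) (2 * π) := fun x φ => by
    simp only [raySource, dir_add_two_pi]
  have hu0 : ∀ φ x, ρ ≤ ‖x‖ → transportSol ρ a (raySource f F) φ x = 0 := fun φ x hx =>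
    transportSol_eq_zero hac hh hh0 hdata φ hx hρ
  set u := transportSol ρ a (raySource f F) with hu
  have huc : Continuous fun z : ℝ × ℂ => u z.1 z.2 := continuous_transportSol hac hh
  have hwc := continuous_holExponent hρ ha
  rcases lt_or_ge ρ ‖x‖ with hx | hx
  · rw [hu0 φ x hx.le, hu0 ψ x hx.le]
  set v : ℝ → ℂ → ℂ := fun φ x => cexp (holExponent ρ a φ x) * (u φ x : ℂ) with hv
  set g : ℝ → ℂ → ℂ := fun φ x => -(cexp (holExponent ρ a φ x) * (raySource f F φ x : ℂ)) with hg
  have hvc : Continuous (Function.uncurry v) :=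
    (Complex.continuous_exp.comp hwc).mul (continuous_ofReal.comp huc)
  have hgc : Continuous (Function.uncurry g) :=
    ((Complex.continuous_exp.comp hwc).mul (continuous_ofReal.comp hh)).neg
  have hvp : ∀ x, Function.Periodic (fun φ => v φ x) (2 * π) := fun x φ => by
    simp only [hv]
    have h1 := holExponent_periodic (ρ := ρ) (a := a) x φ
    have h2 := transportSol_periodic (ρ := ρ) (a := a) hhp x φ
    simp only at h1 h2
    rw [h1, hu, h2]
  have hd : ∀ φ x, HasLineDerivAt ℝ (v φ) (g φ x) x (dir φ) := fun φ x => by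
    have h1 := (hasDerivAt_holExponent (ρ := ρ) hac φ x).cexp.mul
      (hasDerivAt_transportSol (ρ := ρ) hac hh φ x).ofReal_comp
    simp only [HasLineDerivAt, real_smul]
    refine h1.congr_deriv ?_
    simp only [hg, ofReal_zero, zero_mul, add_zero]
    push_cast
    ring
  have hm : ∀ x, ∀ m : ℤ, m ≤ -2 → angMode m (fun φ => g φ x) = 0 := fun x m hm => by
    rcases le_or_gt ‖x‖ ρ with hx | hx
    · have := angMode_mul_raySource (f := f) (F := F)
        (isHardy_holExponent ha ha0 hx).cexp x hm
      have h2 := angMode_const_mul (-1) (fun φ => cexp (holExponent ρ a φ x) *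
        (raySource f F φ x : ℂ)) m
      rw [this, mul_zero] at h2
      simpa only [hg, neg_one_mul] using h2
    · simp only [hg, hh0 _ x hx.le, ofReal_zero, mul_zero, neg_zero, angMode_zero]
  have hvH : IsHardy (fun φ => v φ x) :=
    ⟨hvc.comp (f := fun φ : ℝ => (φ, x)) (by fun_prop), hvp x, fun n hn =>
      angMode_eq_zero_of_lineDeriv (ρ := ρ) hvc hgc hvp (fun φ x hx => by simp [hv, hu0 φ x hx])
        (fun φ x hx => by simp [hg, hh0 φ x hx]) hd hm x hn⟩
  have huH : IsHardy (fun φ => (u φ x : ℂ)) := by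
    have := (isHardy_holExponent ha ha0 hx).neg.cexp.mul hvH
    simpa only [hv, ← mul_assoc, ← Complex.exp_add, neg_add_cancel, Complex.exp_zero,
      one_mul] using this
  exact huH.eq_of_real φ ψ

/-- A function with continuous gradient along all lines is differentiable. -/
lemma hasFDerivAt_of_hasLineDerivAt_inner {P : ℂ → ℝ} (hF : Continuous F)
    (hd : ∀ x θ : ℂ, HasLineDerivAt ℝ P (inner ℝ (F x) θ) x θ) (x : ℂ) :
    HasFDerivAt P (innerSL ℝ (F x)) x := by
  rw [hasFDerivAt_iff_isLittleO, Asymptotics.isLittleO_iff]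
  intro ε hε
  obtain ⟨δ, hδ, hFδ⟩ := Metric.continuous_iff.mp hF x ε hε
  filter_upwards [Metric.ball_mem_nhds x hδ] with y hy
  have hder : ∀ t : ℝ, HasDerivAt (fun t : ℝ => P (x + t • (y - x)) - t * inner ℝ (F x) (y - x))
      (inner ℝ (F (x + t • (y - x)) - F x) (y - x)) t := by
    intro t
    have h1 := hd (x + t • (y - x)) (y - x)
    rw [HasLineDerivAt, ← sub_self t] at h1
    have h2 := h1.comp_sub_const t t
    have h3 := h2.sub ((hasDerivAt_id t).mul_const (inner ℝ (F x) (y - x)))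
    rw [one_mul, ← inner_sub_left] at h3
    refine h3.congr_of_eventuallyEq (Eventually.of_forall fun s => ?_)
    simp only [Pi.sub_apply, id]
    congr 2
    module
  have hb := norm_image_sub_le_of_norm_deriv_le_segment_01' (C := ε * ‖y - x‖)
    (fun t _ => (hder t).hasDerivWithinAt) (fun t ht => by
      refine (norm_inner_le_norm _ _).trans ?_
      refine mul_le_mul_of_nonneg_right ?_ (norm_nonneg _)
      rw [← dist_eq_norm]
      refine (hFδ _ ?_).le
      rw [dist_eq_norm, add_sub_cancel_left, norm_smul, Real.norm_eq_abs, abs_of_nonneg ht.1]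
      rw [mem_ball_iff_norm] at hy
      nlinarith [norm_nonneg (y - x), ht.2])
  simpa [sub_right_comm, innerSL_apply_apply] using hb

/-- The kernel of the attenuated transform on pairs: if the transform of `f - θ · F` vanishes,
there is a potential `P`, compactly supported, with `F = ∇P` and `f = -a P`. -/
theorem exists_potential {K : ℝ≥0} (hρ : 0 ≤ ρ) (ha : LipschitzWith K a)
    (ha0 : ∀ x, ρ ≤ ‖x‖ → a x = 0) (hf : Continuous f) (hf0 : ∀ x, ρ ≤ ‖x‖ → f x = 0)
    (hF : Continuous F) (hF0 : ∀ x, ρ ≤ ‖x‖ → F x = 0)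
    (hdata : ∀ φ s, ∫ σ in (-ρ)..ρ, raySource f F φ (linePt φ σ s) *
      Real.exp (-lineFwd ρ a φ σ s) = 0) :
    ∃ P : ℂ → ℝ, (∀ x, ρ ≤ ‖x‖ → P x = 0) ∧ (∀ x, HasFDerivAt P (innerSL ℝ (F x)) x) ∧
      ∀ x, f x = -(a x * P x) := by
  have hac := ha.continuous
  have hh := continuous_raySource hf hF
  set P : ℂ → ℝ := fun x => transportSol ρ a (raySource f F) 0 x with hP
  have hPφ : ∀ φ x, transportSol ρ a (raySource f F) φ x = P x := fun φ x =>
    transportSol_eq_of_data hρ ha ha0 hf hf0 hF hF0 hdata φ 0 x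
  have hd : ∀ φ x, HasLineDerivAt ℝ P
      (-(a x * P x) - f x + (F x * conj (dir φ)).re) x (dir φ) := fun φ x => by
    have := hasDerivAt_transportSol (ρ := ρ) hac hh φ x
    simp only [hPφ] at this
    simp only [HasLineDerivAt, real_smul]
    refine this.congr_deriv ?_
    rw [raySource]; ring
  -- Comparing the directions `θ` and `-θ` separates the even and the odd part.
  have hfP : ∀ x, f x = -(a x * P x) := fun x => by
    have h1 := (hd 0 x).smul (-1)
    have h2 := hd (0 + π) x
    rw [dir_add_pi] at h2
    rw [neg_one_smul ℝ (dir 0)] at h1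
    have := h1.unique h2
    simp only [smul_eq_mul, map_neg, mul_neg, neg_re] at this
    linarith
  have hd' : ∀ x θ : ℂ, HasLineDerivAt ℝ P (inner ℝ (F x) θ) x θ := by
    intro x θ
    have h1 := (hd (arg θ) x).smul ‖θ‖
    have hθ : ‖θ‖ • dir (arg θ) = θ := by
      rw [real_smul]; exact Complex.norm_mul_exp_arg_mul_I θ
    rw [hθ, hfP x, sub_self, zero_add] at h1
    have h2 : inner ℝ (F x) θ = ‖θ‖ • (F x * conj (dir (arg θ))).re := by
      conv_lhs => rw [← hθ]
      rw [real_inner_smul_right, real_inner_comm, Complex.inner, smul_eq_mul]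
    rw [h2]
    exact h1
  refine ⟨P, fun x hx => ?_, fun x => hasFDerivAt_of_hasLineDerivAt_inner hF hd' x, hfP⟩
  exact transportSol_eq_zero hac hh (fun φ x hx => by
    simp [raySource, hf0 x hx, hF0 x hx]) hdata 0 hx hρ

end Potential

/-! ### Divergence free gradient fields, and the passage to the Euclidean plane -/

/-- A gradient field with zero divergence in `U` is the conjugate of a holomorphic function, so
the maximum principle applies to it. -/
theorem eq_zero_of_gradient_of_divergence {U : Set ℂ} (hU : IsOpen U)
    (hUb : Bornology.IsBounded U) {P : ℂ → ℝ} {F : ℂ → ℂ} {F' : ℂ → ℂ →L[ℝ] ℂ}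
    (hF : Continuous F) (hF0 : ∀ x, x ∉ U → F x = 0)
    (hP : ∀ x, HasFDerivAt P (innerSL ℝ (F x)) x) (hF' : ∀ x ∈ U, HasFDerivAt F (F' x) x)
    (hdiv : ∀ x ∈ U, (F' x 1).re + (F' x I).im = 0) (x : ℂ) : F x = 0 := by
  have hP' : ∀ y, HasFDerivAt P ((F y).re • reCLM + (F y).im • imCLM) y := fun y => by
    refine (hP y).congr_fderiv (ContinuousLinearMap.ext fun w => ?_)
    simp [innerSL_apply_apply, Complex.inner]
    ring
  have hsymm : ∀ x ∈ U, (F' x 1).im = (F' x I).re := fun x hx => by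
    have h1 : HasFDerivAt (fun y => (F y).re • reCLM + (F y).im • imCLM)
        ((reCLM.comp (F' x)).smulRight reCLM + (imCLM.comp (F' x)).smulRight imCLM) x :=
      ((reCLM.hasFDerivAt.comp x (hF' x hx)).smul_const reCLM).add
        ((imCLM.hasFDerivAt.comp x (hF' x hx)).smul_const imCLM)
    simpa using second_derivative_symmetric hP' h1 1 I
  have hdiff : DifferentiableOn ℂ (fun y => conj (F y)) U := fun y hy => by
    refine DifferentiableAt.differentiableWithinAt ?_
    have h1 : HasFDerivAt (fun y => conj (F y)) ((conjCLE : ℂ →L[ℝ] ℂ).comp (F' y)) y :=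
      (conjCLE : ℂ →L[ℝ] ℂ).hasFDerivAt.comp y (hF' y hy)
    rw [differentiableAt_complex_iff_differentiableAt_real, h1.fderiv]
    refine ⟨h1.differentiableAt, ?_⟩
    have h2 := hsymm y hy
    have h3 := hdiv y hy
    apply Complex.ext
    · simp; linarith
    · simp; linarith
  by_cases hx : x ∈ U
  · have h := Complex.eqOn_of_eqOn_frontier hUb
      ⟨hdiff, (continuous_conj.comp hF).continuousOn⟩
      (diffContOnCl_const (c := (0 : ℂ))) (fun y hy => by
        simp only [hF0 y (fun h => (hU.frontier_eq ▸ hy).2 h), map_zero]) hx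
    simpa using h
  · exact hF0 x hx

section Domain

variable {Ω : Set Plane}

/-- The derivative is bounded in `Ω`; a segment that leaves `Ω` is cut at its first point outside,
where the function vanishes. -/
lemma IsC1Zero.exists_lipschitz (hΩ : IsStrictlyConvexDomain Ω) {a : Plane → ℝ}
    (ha : IsC1Zero Ω a) : ∃ K : ℝ≥0, LipschitzWith K a := by
  obtain ⟨a', hac, had⟩ := ha.exists_fderiv
  obtain ⟨C, hC⟩ := hΩ.isBounded.isCompact_closure.exists_bound_of_continuousOn hac
  have key : ∀ x ∈ Ω, ∀ y, |a y - a x| ≤ max C 0 * ‖y - x‖ := by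
    intro x hx y
    obtain ⟨t₀, ht₀, hin, hout⟩ : ∃ t₀ ∈ Icc (0 : ℝ) 1, (∀ t ∈ Ico 0 t₀, x + t • (y - x) ∈ Ω) ∧
        a (x + t₀ • (y - x)) = a y := by
      have hlc : Continuous fun t : ℝ => x + t • (y - x) := by fun_prop
      by_cases hy : y ∈ Ω
      · exact ⟨1, by simp, fun t ht => hΩ.convex.add_smul_sub_mem hx hy ⟨ht.1, ht.2.le⟩, by simp⟩
      · obtain ⟨t₀, ht₀, hmin⟩ := (isCompact_Icc.inter_right
          (hΩ.isOpen.isClosed_compl.preimage hlc)).exists_isLeast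
          (⟨1, by simp [hy]⟩ : (Icc (0 : ℝ) 1 ∩ (fun t : ℝ => x + t • (y - x)) ⁻¹' Ωᶜ).Nonempty)
        refine ⟨t₀, ht₀.1, fun t ht => ?_, ?_⟩
        · by_contra h
          exact absurd (hmin ⟨⟨ht.1, ht.2.le.trans ht₀.1.2⟩, h⟩) (not_le.mpr ht.2)
        · rw [ha.eq_zero_of_notMem _ ht₀.2, ha.eq_zero_of_notMem _ hy]
    have hb := norm_image_sub_le_of_norm_deriv_right_le_segment
      (f := fun t : ℝ => a (x + t • (y - x))) (a := 0) (b := t₀) (C := max C 0 * ‖y - x‖)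
      (f' := fun t => a' (x + t • (y - x)) (y - x))
      (ha.continuous.comp (by fun_prop)).continuousOn
      (fun t ht => by
        have h1 : HasDerivAt (fun t : ℝ => x + t • (y - x)) (y - x) t := by
          simpa using ((hasDerivAt_id t).smul_const (y - x)).const_add x
        exact ((had _ (hin t ht)).comp_hasDerivAt t h1).hasDerivWithinAt)
      (fun t ht => (ContinuousLinearMap.le_opNorm _ _).trans <| by
        gcongr
        exact (hC _ (subset_closure (hin t ht))).trans (le_max_left _ _))
      t₀ ⟨ht₀.1, le_rfl⟩
    simp only [hout, zero_smul, add_zero, sub_zero, Real.norm_eq_abs] at hb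
    refine hb.trans (mul_le_of_le_one_right (by positivity) ht₀.2)
  refine ⟨⟨max C 0, le_max_right _ _⟩, LipschitzWith.of_dist_le_mul fun x y => ?_⟩
  rw [Real.dist_eq, dist_eq_norm]
  change _ ≤ max C 0 * _
  by_cases hx : x ∈ Ω
  · rw [abs_sub_comm, norm_sub_rev]
    exact key x hx y
  · by_cases hy : y ∈ Ω
    · exact key y hy x
    · rw [ha.eq_zero_of_notMem x hx, ha.eq_zero_of_notMem y hy, sub_self, abs_zero]
      positivity

lemma tauPlus_nonneg (x θ : Plane) : 0 ≤ tauPlus Ω x θ :=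
  Real.sSup_nonneg fun _ ht => ht.1

lemma notMem_closure_of_tauPlus_lt (hΩ : Bornology.IsBounded Ω) {x θ : Plane} (hθ : ‖θ‖ = 1)
    {t : ℝ} (ht : tauPlus Ω x θ < t) : x + t • θ ∉ closure Ω := by
  intro hmem
  have hset : t ∈ {t : ℝ | 0 ≤ t ∧ x + t • θ ∈ closure Ω} :=
    ⟨(tauPlus_nonneg x θ).trans ht.le, hmem⟩
  refine absurd (le_csSup ?_ hset) (not_le.mpr ht)
  obtain ⟨R, hR⟩ := hΩ.closure.exists_norm_le
  refine ⟨R + ‖x‖, fun r hr => ?_⟩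
  have h1 : ‖r • θ‖ = r := by rw [norm_smul, hθ, mul_one, Real.norm_eq_abs, abs_of_nonneg hr.1]
  have h2 := norm_sub_le (x + r • θ) x
  rw [add_sub_cancel_left, h1] at h2
  exact h2.trans (by gcongr; exact hR _ hr.2)

lemma notMem_of_notMem_chord (hΩ : Bornology.IsBounded Ω) {x θ : Plane} (hθ : ‖θ‖ = 1)
    {t : ℝ} (ht : t ∉ Icc (-tauMinus Ω x θ) (tauPlus Ω x θ)) : x + t • θ ∉ Ω := by
  rw [mem_Icc, not_and_or, not_le, not_le] at ht
  refine fun h => ?_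
  rcases ht with ht | ht
  · refine notMem_closure_of_tauPlus_lt hΩ (x := x) (θ := -θ) (t := -t) (by rwa [norm_neg])
      (by rw [tauMinus] at ht; linarith) ?_
    rw [smul_neg, neg_smul, neg_neg]
    exact subset_closure h
  · exact notMem_closure_of_tauPlus_lt hΩ hθ ht (subset_closure h)

/-- The identification of the complex numbers with the Euclidean plane. -/
noncomputable def complexPlane : ℂ ≃ₗᵢ[ℝ] Plane := Complex.orthonormalBasisOneI.repr

lemma complexPlane_linePt (φ p s t : ℝ) :
    complexPlane (linePt φ (p + t) s)
      = complexPlane (linePt φ p s) + t • complexPlane (dir φ) := by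
  rw [← map_smul, ← map_add, linePt, linePt, real_smul]
  congr 1
  push_cast
  ring

lemma divBeam_eq_lineFwd (hΩ : Bornology.IsBounded Ω) {ρ : ℝ}
    (hΩρ : ∀ x : ℂ, ρ ≤ ‖x‖ → complexPlane x ∉ Ω) {a : Plane → ℝ} (ha : Continuous a)
    (ha0 : ∀ x, x ∉ Ω → a x = 0) (φ p s : ℝ) :
    divBeam Ω a (complexPlane (linePt φ p s)) (complexPlane (dir φ))
      = lineFwd ρ (fun x => a (complexPlane x)) φ p s := by
  have hθ : ‖complexPlane (dir φ)‖ = 1 := by rw [LinearIsometryEquiv.norm_map, norm_dir]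
  have hc : Continuous fun t : ℝ =>
      a (complexPlane (linePt φ p s) + t • complexPlane (dir φ)) := by fun_prop
  have h1 : lineFwd ρ (fun x => a (complexPlane x)) φ p s
      = ∫ t in (0 : ℝ)..(ρ - p), a (complexPlane (linePt φ p s) + t • complexPlane (dir φ)) := by
    simp only [← complexPlane_linePt]
    rw [intervalIntegral.integral_comp_add_left (fun σ => a (complexPlane (linePt φ σ s))),
      add_zero, add_sub_cancel, lineFwd]
  rw [h1, divBeam, ← intervalIntegral.integral_add_adjacent_intervals
    (b := chordLength Ω (complexPlane (linePt φ p s)) (complexPlane (dir φ)))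
    (c := ρ - p) (hc.intervalIntegrable _ _) (hc.intervalIntegrable _ _), left_eq_add]
  refine intervalIntegral.integral_zero_ae (Eventually.of_forall fun t ht => ha0 _ ?_)
  rcases min_lt_iff.mp ht.1 with h | h
  · have h2 : tauPlus Ω (complexPlane (linePt φ p s)) (complexPlane (dir φ)) < t := by
      refine lt_of_le_of_lt ?_ h
      rw [chordLength]
      exact le_add_of_nonneg_right (tauPlus_nonneg _ _)
    exact fun h' => notMem_closure_of_tauPlus_lt hΩ hθ h2 (subset_closure h')
  · rw [← complexPlane_linePt]
    refine hΩρ _ (le_trans ?_ (le_norm_linePt _ _ _))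
    exact (by linarith : ρ ≤ p + t).trans (le_abs_self _)

lemma integral_chord_eq (hΩ : Bornology.IsBounded Ω) {ρ : ℝ} (hρ : 0 ≤ ρ)
    (hΩρ : ∀ x : ℂ, ρ ≤ ‖x‖ → complexPlane x ∉ Ω) (φ p s : ℝ) {G : ℝ → ℝ}
    (hG : ∀ σ, complexPlane (linePt φ σ s) ∉ Ω → G σ = 0) :
    ∫ t in (-tauMinus Ω (complexPlane (linePt φ p s)) (complexPlane (dir φ)))..
      tauPlus Ω (complexPlane (linePt φ p s)) (complexPlane (dir φ)), G (p + t)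
      = ∫ σ in (-ρ)..ρ, G σ := by
  have hθ : ‖complexPlane (dir φ)‖ = 1 := by rw [LinearIsometryEquiv.norm_map, norm_dir]
  rw [← integral_eq_intervalIntegral_of_eq_zero, ← integral_eq_intervalIntegral_of_eq_zero,
    integral_add_left_eq_self]
  · linarith
  · refine fun σ hσ => hG σ (hΩρ _ (le_trans ?_ (le_norm_linePt _ _ _)))
    by_contra! h
    exact hσ (abs_le.mp h.le)
  · have h1 := tauPlus_nonneg (Ω := Ω) (complexPlane (linePt φ p s)) (complexPlane (dir φ))
    have h2 := tauPlus_nonneg (Ω := Ω) (complexPlane (linePt φ p s)) (-complexPlane (dir φ))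
    rw [tauMinus]
    linarith
  · refine fun t ht => hG _ ?_
    rw [complexPlane_linePt]
    exact notMem_of_notMem_chord hΩ hθ ht

lemma inner_complexPlane (θ : ℂ) (w : Plane) :
    inner ℝ (complexPlane θ) w = (complexPlane.symm w * conj θ).re := by
  conv_lhs => rw [← complexPlane.apply_symm_apply w]
  rw [LinearIsometryEquiv.inner_map_map, Complex.inner]

lemma integral_raySource_eq_zero (hΩ : Bornology.IsBounded Ω) {ρ : ℝ} (hρ : 0 ≤ ρ)
    (hΩρ : ∀ x : ℂ, ρ ≤ ‖x‖ → complexPlane x ∉ Ω) {a f : Plane → ℝ} {F : Plane → Plane}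
    (ha : Continuous a) (ha0 : ∀ x, x ∉ Ω → a x = 0) (hf : Continuous f)
    (hf0 : ∀ x, x ∉ Ω → f x = 0) (hF : Continuous F) (hF0 : ∀ x, x ∉ Ω → F x = 0)
    (hdata : ∀ x ∈ Ω, ∀ θ : Plane, ‖θ‖ = 1 →
      attenuatedDoppler Ω a F x θ = attenuatedXray Ω a f x θ) (φ s : ℝ) :
    ∫ σ in (-ρ)..ρ, raySource (fun x => f (complexPlane x))
        (fun x => complexPlane.symm (F (complexPlane x))) φ (linePt φ σ s) *
      Real.exp (-lineFwd ρ (fun x => a (complexPlane x)) φ σ s) = 0 := by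
  by_cases hne : ∃ p, complexPlane (linePt φ p s) ∈ Ω
  · obtain ⟨p, hp⟩ := hne
    have hθ : ‖complexPlane (dir φ)‖ = 1 := by rw [LinearIsometryEquiv.norm_map, norm_dir]
    have h := hdata _ hp _ hθ
    rw [attenuatedDoppler, attenuatedXray] at h
    simp only [← complexPlane_linePt, divBeam_eq_lineFwd hΩ hΩρ ha ha0] at h
    rw [integral_chord_eq hΩ hρ hΩρ φ p s (G := fun σ => inner ℝ (complexPlane (dir φ))
        (F (complexPlane (linePt φ σ s))) *
          Real.exp (-lineFwd ρ (fun x => a (complexPlane x)) φ σ s))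
        (fun σ hσ => by rw [hF0 _ hσ, inner_zero_right, zero_mul]),
      integral_chord_eq hΩ hρ hΩρ φ p s (G := fun σ => f (complexPlane (linePt φ σ s)) *
          Real.exp (-lineFwd ρ (fun x => a (complexPlane x)) φ σ s))
        (fun σ hσ => by rw [hf0 _ hσ, zero_mul])] at h
    have hl : Continuous fun σ => linePt φ σ s :=
      continuous_linePt.comp (f := fun σ : ℝ => (φ, σ, s)) (by fun_prop)
    have hw : Continuous fun σ => lineFwd ρ (fun x => a (complexPlane x)) φ σ s :=
      (continuous_lineFwd (ρ := ρ) (a := fun x => a (complexPlane x)) (by fun_prop)).comp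
        (f := fun σ : ℝ => (φ, σ, s)) (by fun_prop)
    simp only [raySource, sub_mul]
    rw [intervalIntegral.integral_sub]
    · simp only [← inner_complexPlane]
      rw [h, sub_self]
    · exact Continuous.intervalIntegrable (by fun_prop) _ _
    · exact Continuous.intervalIntegrable (by fun_prop) _ _
  · push Not at hne
    simp [raySource, hf0 _ (hne _), hF0 _ (hne _)]

end Domain

end RayData

theorem corollary5p2 (Ω : Set RayData.Plane) (hΩ : RayData.IsStrictlyConvexDomain Ω)
    (a : RayData.Plane → ℝ) (ha : RayData.IsC1Zero Ω a)
    (F : RayData.Plane → RayData.Plane) (hF : RayData.IsC1Zero Ω F)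
    (hsol : RayData.IsSolenoidal Ω F)
    (f : RayData.Plane → ℝ) (hf : RayData.IsC1Zero Ω f)
    (hdata : (∃ g : RayData.Plane → RayData.Plane → ℝ,
        RayData.IsDopplerData Ω a F g ∧ RayData.IsXrayData Ω a f g) ∨
      (∀ x ∈ Ω, ∀ θ : RayData.Plane, ‖θ‖ = 1 →
        RayData.attenuatedDoppler Ω a F x θ = RayData.attenuatedXray Ω a f x θ)) :
    (∀ x ∈ closure Ω, ∀ θ : RayData.Plane, ‖θ‖ = 1 →
      RayData.attenuatedDoppler Ω a F x θ = 0 ∧ RayData.attenuatedXray Ω a f x θ = 0) ∧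
    (∀ x, F x = 0) ∧ (∀ x, f x = 0) := by
  open RayData in
  have hdata' : ∀ x ∈ Ω, ∀ θ : Plane, ‖θ‖ = 1 →
      attenuatedDoppler Ω a F x θ = attenuatedXray Ω a f x θ := by
    rcases hdata with ⟨g, hD, hX⟩ | h
    · intro x hx θ hθ
      rw [← hD x (subset_closure hx) θ hθ, ← hX x (subset_closure hx) θ hθ]
    · exact h
  suffices h : (∀ x, F x = 0) ∧ ∀ x, f x = 0 by
    refine ⟨fun x _ θ _ => ⟨?_, ?_⟩, h⟩
    · simp [attenuatedDoppler, h.1]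
    · simp [attenuatedXray, h.2]
  obtain ⟨K, hK⟩ := ha.exists_lipschitz hΩ
  obtain ⟨R, hR0, hR⟩ := hΩ.isBounded.exists_pos_norm_le
  have hΩρ : ∀ x : ℂ, R + 1 ≤ ‖x‖ → complexPlane x ∉ Ω := fun x hx h => by
    have := hR _ h
    rw [LinearIsometryEquiv.norm_map] at this
    linarith
  have hρ : 0 ≤ R + 1 := by linarith
  have hFc : Continuous fun x => complexPlane.symm (F (complexPlane x)) := by
    have := hF.continuous
    fun_prop
  have hac : LipschitzWith K fun x => a (complexPlane x) := by
    have := hK.comp complexPlane.lipschitz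
    rw [mul_one] at this
    exact this
  obtain ⟨P, hP0, hPF, hPf⟩ := exists_potential hρ hac
    (fun x hx => ha.eq_zero_of_notMem _ (hΩρ x hx))
    (hf.continuous.comp complexPlane.continuous)
    (fun x hx => hf.eq_zero_of_notMem _ (hΩρ x hx)) hFc
    (fun x hx => by rw [hF.eq_zero_of_notMem _ (hΩρ x hx), map_zero])
    (integral_raySource_eq_zero hΩ.isBounded hρ hΩρ ha.continuous ha.eq_zero_of_notMem
      hf.continuous hf.eq_zero_of_notMem hF.continuous hF.eq_zero_of_notMem hdata')
  obtain ⟨F', -, hF'⟩ := hF.exists_fderiv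
  have e0 : complexPlane 1 = EuclideanSpace.single 0 1 := by
    ext i; fin_cases i <;> simp [complexPlane]
  have e1 : complexPlane Complex.I = EuclideanSpace.single 1 1 := by
    ext i; fin_cases i <;> simp [complexPlane]
  have hFz : ∀ x, complexPlane.symm (F (complexPlane x)) = 0 :=
    eq_zero_of_gradient_of_divergence (U := complexPlane ⁻¹' Ω)
      (F' := fun x => (complexPlane.symm.toContinuousLinearEquiv : Plane →L[ℝ] ℂ).comp
        ((F' (complexPlane x)).comp (complexPlane.toContinuousLinearEquiv : ℂ →L[ℝ] Plane)))
      (hΩ.isOpen.preimage complexPlane.continuous)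
      (complexPlane.antilipschitz.isBounded_preimage hΩ.isBounded) hFc
      (fun x hx => by rw [hF.eq_zero_of_notMem _ hx, map_zero]) hPF
      (fun x hx =>
        (complexPlane.symm.toContinuousLinearEquiv : Plane →L[ℝ] ℂ).hasFDerivAt.comp x
          ((hF' _ hx).comp x
            (complexPlane.toContinuousLinearEquiv : ℂ →L[ℝ] Plane).hasFDerivAt))
      (fun x hx => by
        have h := hsol _ hx
        rw [divergence, Fin.sum_univ_two, (hF' _ hx).fderiv] at h
        rw [← e0, ← e1] at h
        simpa [complexPlane] using h)
  have hPz : ∀ x, P x = 0 := fun x => by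
    have hc := is_const_of_fderiv_eq_zero (𝕜 := ℝ) (f := P)
      (fun y => (hPF y).differentiableAt) (fun y => by rw [(hPF y).fderiv, hFz y, map_zero])
      x ((R + 1 : ℝ) : ℂ)
    rw [hc]
    refine hP0 _ ?_
    rw [Complex.norm_real, Real.norm_eq_abs, abs_of_nonneg hρ]
  refine ⟨fun x => ?_, fun x => ?_⟩
  · have := hFz (complexPlane.symm x)
    rwa [complexPlane.apply_symm_apply, map_eq_zero_iff _ complexPlane.symm.injective] at this
  · have := hPf (complexPlane.symm x)
    rw [hPz, mul_zero, neg_zero] at this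
    simpa using this
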